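/- Let $n\ge 1$, let $\mathbb{R}_n$ be the real Clifford algebra generated by $e_1,\dots,e_n$ with $e_i^2=-1$, $e_ie_j=-e_je_i$ ($i\neq j$), with conjugation $a\mapsto\bar a$ (the real-linear anti-automorphism with $\bar e_i=-e_i$) and with $|a|=(\sum_\alpha a_\alpha^2)^{1/2}$ for $a=\sum_\alpha a_\alpha e_\alpha$. Identify $\mathbb{R}^{n+1}$ with the paravectors $s=s_0+\sum_{i=1}^n s_ie_i$ and put ${\rm Re}(s)=s_0$. Fix $\mathfrak{I}=\sum_{i=1}^n\mathfrak{I}_ie_i$ with $\sum_i\mathfrak{I}_i^2=1$, so that $\mathfrak{I}^2=-1$; let $\mathbb{C}_{\mathfrak{I}}=\mathbb{R}+\mathbb{R}\mathfrak{I}$ and $\mathbb{C}_{\mathfrak{I}}^+=\{u+v\mathfrak{I}:v\ge 0\}$. Let $\mathcal{H}$ be a real Hilbert space and $\mathcal{H}_n=\mathcal{H}\otimes\mathbb{R}_n$ the right $\mathbb{R}_n$-module of all $x=\sum_\alpha x_\alpha\otimes e_\alpha$, with norm $\|x\|=(\sum_\alpha\|x_\alpha\|^2)^{1/2}$ and $\mathbb{R}_n$-valued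 inner product $\langle x,y\rangle=\sum_{\alpha,\beta}\langle x_\alpha,y_\beta\rangle_{\mathcal H}\,\bar e_\beta e_\alpha$. Operators are right $\mathbb{R}_n$-linear; adjoints are taken with respect to $\langle\cdot,\cdot\rangle$. For an operator $T$ with domain $\mathcal{D}(T)\subseteq\mathcal{H}_n$ and $s\in\mathbb{R}^{n+1}$ put $\mathcal{Q}_s(T)=T^2-2{\rm Re}(s)T+|s|^2I$ on $\mathcal{D}(T^2)$; the $S$-spectrum $\sigma_S(T)$ is the set of all $s\in\mathbb{R}^{n+1}$ for which it is not the case that $\mathcal{Q}_s(T)$ has trivial kernel, dense range and bounded inverse on its range. Let $\Omega\subseteq\mathbb{C}_{\mathfrak{I}}^+$ and let $E$ be a spectral measure on the Borel $\sigma$-algebra of $\Omega$, i.e. a map into the orthogonal projections of $\mathcal{H}_n$ that is countably additive in the strong operator topology with $E(\Omega)=I$. Let $J$ be an imaginary operator associated with $E$: a bounded operator on $\mathcal{H}_n$ with $J^*=-J$, $JJ^*=J^*J=I$ and $JE(M)=E(M)J$ for all Borel sets $M\subseteq\Omega$. Let $f:\Omega\to\mathbb{C}_{\mathfrak{I}}\cup\{\infty\}$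 be Borel measurable with $E(\{f=\infty\})=0$, and suppose that $f$ is intrinsic: wherever it is finite, $f(u+v\mathfrak{I})=f_0(u,v)+\mathfrak{I}f_1(u,v)$ with real-valued $f_0,f_1$ satisfying $f_0(u,-v)=f_0(u,v)$ and $f_1(u,-v)=-f_1(u,v)$. Let $\mathbb{I}(f)$ be the spectral integral of $f$: for simple $\varphi=\sum_k c_k\chi_{M_k}$ with disjoint $M_k$, $\mathbb{I}(\varphi)=\sum_k({\rm Re}(c_k)E(M_k)+{\rm Im}(c_k)E(M_k)J)$, where $c={\rm Re}(c)+{\rm Im}(c)\mathfrak{I}$; for bounded Borel $g:\Omega\to\mathbb{C}_{\mathfrak{I}}$, $\mathbb{I}(g)$ is the operator norm limit of $\mathbb{I}(\varphi_j)$ for simple $\varphi_j\to g$ uniformly; and in general $\mathbb{I}(f)x=\lim_{j\to\infty}\mathbb{I}(f\chi_{\{|f|\le j\}})x$ on the domain $\mathcal{D}(\mathbb{I}(f))=\{x\in\mathcal{H}_n:\int_\Omega|f|^2\,d({\rm Re}\langle E(\cdot)x,x\rangle)<\infty\}$. Then $$\sigma_S(\mathbb{I}(f))\cap\mathbb{C}_{\mathfrak{I}}^+=\{s\in\mathbb{C}_{\mathfrak{I}}^+: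 E(\{\lambda\in\Omega:|f(\lambda)^2-2{\rm Re}(s)f(\lambda)+|s|^2|<\varepsilon\})\neq 0\ \text{ for all }\varepsilon>0\}.$$ -/

import Mathlib

open MeasureTheory Filter Topology
open scoped symmDiff ENNReal

noncomputable section

namespace CliffordSpectral

/-! ### The Clifford algebra `ℝ_n` with `e_i ^ 2 = -1` -/

/-- The sign in `e_α * e_β = sgn α β • e_(α ∆ β)`: each pair `i ∈ α`, `j ∈ β` with `j < i`
contributes a transposition, each `i ∈ α ∩ β` contributes `e_i ^ 2 = -1`. -/
def sgn {n : ℕ} (α β : Finset (Fin n)) : ℝ := ∏ i ∈ α, ∏ j ∈ β, if j ≤ i then -1 else 1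

theorem sgn_sq_factor {n : ℕ} (i j : Fin n) :
    (if j ≤ i then (-1 : ℝ) else 1) * (if j ≤ i then -1 else 1) = 1 := by
  split_ifs <;> norm_num

theorem prod_symmDiff_of_sq {n : ℕ} (g : Fin n → ℝ) (hg : ∀ i, g i * g i = 1)
    (α β : Finset (Fin n)) : ∏ i ∈ α ∆ β, g i = (∏ i ∈ α, g i) * ∏ i ∈ β, g i := by
  have h1 : α ∆ β = (α \ β) ∪ (β \ α) := rfl
  have hd : Disjoint (α \ β) (β \ α) := disjoint_sdiff_sdiff
  rw [h1, Finset.prod_union hd, ← Finset.prod_sdiff (Finset.inter_subset_left (s₁ := α) (s₂ := β)),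
    ← Finset.prod_sdiff (Finset.inter_subset_right (s₁ := α) (s₂ := β))]
  have h2 : (∏ i ∈ α ∩ β, g i) * ∏ i ∈ α ∩ β, g i = 1 := by
    rw [← Finset.prod_mul_distrib]; exact Finset.prod_eq_one fun i _ => hg i
  rw [Finset.sdiff_inter_self_left, Finset.sdiff_inter_self_right]
  linear_combination (-(∏ i ∈ α \ β, g i) * ∏ i ∈ β \ α, g i) * h2

theorem sgn_symmDiff_left {n : ℕ} (α β γ : Finset (Fin n)) :
    sgn (α ∆ β) γ = sgn α γ * sgn β γ := by
  refine prod_symmDiff_of_sq _ (fun i => ?_) α β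
  rw [← Finset.prod_mul_distrib]
  exact Finset.prod_eq_one fun j _ => sgn_sq_factor i j

theorem sgn_symmDiff_right {n : ℕ} (α β γ : Finset (Fin n)) :
    sgn α (β ∆ γ) = sgn α β * sgn α γ := by
  unfold sgn
  rw [← Finset.prod_mul_distrib]
  exact Finset.prod_congr rfl fun i _ => prod_symmDiff_of_sq _ (sgn_sq_factor i) β γ

/-- Clifford numbers `a = ∑ α, a α • e_α`, where `α` runs over the subsets of `{1, …, n}`. -/
def Cl (n : ℕ) : Type := Finset (Fin n) → ℝ

namespace Cl

variable {n : ℕ}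

instance : AddCommGroup (Cl n) := inferInstanceAs (AddCommGroup (Finset (Fin n) → ℝ))
instance : Module ℝ (Cl n) := inferInstanceAs (Module ℝ (Finset (Fin n) → ℝ))

/-- The basis vector `e_α`; `e ∅ = 1`. -/
def e (α : Finset (Fin n)) : Cl n := fun β => if β = α then 1 else 0

instance : One (Cl n) := ⟨e ∅⟩

/-- The bilinear product with `e_α * e_β = sgn α β • e_(α ∆ β)`. -/
instance : Mul (Cl n) := ⟨fun a b γ => ∑ α, sgn α (α ∆ γ) * a α * b (α ∆ γ)⟩

theorem add_apply (a b : Cl n) (γ : Finset (Fin n)) : (a + b) γ = a γ + b γ := rfl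
theorem zero_apply (γ : Finset (Fin n)) : (0 : Cl n) γ = 0 := rfl
theorem smul_apply (c : ℝ) (a : Cl n) (γ : Finset (Fin n)) : (c • a) γ = c * a γ := rfl
theorem one_apply (γ : Finset (Fin n)) : (1 : Cl n) γ = if γ = ∅ then 1 else 0 := rfl
theorem mul_apply (a b : Cl n) (γ : Finset (Fin n)) :
    (a * b) γ = ∑ α, sgn α (α ∆ γ) * a α * b (α ∆ γ) := rfl

@[ext] theorem ext {a b : Cl n} (h : ∀ γ, a γ = b γ) : a = b := funext h

theorem sgn_assoc (α δ γ : Finset (Fin n)) :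
    sgn (α ∆ δ) ((α ∆ δ) ∆ γ) * sgn α δ = sgn α (α ∆ γ) * sgn δ (δ ∆ (α ∆ γ)) := by
  have h : (α ∆ δ) ∆ γ = δ ∆ (α ∆ γ) := by
    rw [symmDiff_comm α δ, symmDiff_assoc]
  have h2 : sgn α (α ∆ γ) = sgn α δ * sgn α (δ ∆ (α ∆ γ)) := by
    rw [← sgn_symmDiff_right, symmDiff_symmDiff_cancel_left]
  rw [h, sgn_symmDiff_left, h2]
  ring

/-- Substitution `β = α ∆ δ` in a sum over subsets. -/
theorem sum_symmDiff {M : Type*} [AddCommMonoid M] (α : Finset (Fin n))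
    (g : Finset (Fin n) → M) : ∑ δ, g (α ∆ δ) = ∑ β, g β :=
  Fintype.sum_bijective (fun δ => α ∆ δ)
    (Function.Involutive.bijective fun δ => symmDiff_symmDiff_cancel_left α δ) _ _ fun _ => rfl

instance : Ring (Cl n) :=
  { (inferInstance : AddCommGroup (Cl n)), (inferInstance : Mul (Cl n)),
    (inferInstance : One (Cl n)) with
    left_distrib := fun a b c => by
      ext γ; simp only [mul_apply, add_apply, mul_add, Finset.sum_add_distrib]
    right_distrib := fun a b c => by
      ext γ; simp only [mul_apply, add_apply, mul_add, add_mul, Finset.sum_add_distrib]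
    zero_mul := fun a => by ext γ; simp [mul_apply, zero_apply]
    mul_zero := fun a => by ext γ; simp [mul_apply, zero_apply]
    one_mul := fun a => by
      ext γ
      rw [mul_apply, Finset.sum_eq_single ∅]
      · have h : (∅ : Finset (Fin n)) ∆ γ = γ := bot_symmDiff γ
        simp [one_apply, sgn, h]
      · intro b _ hb; simp [one_apply, hb]
      · simp
    mul_one := fun a => by
      ext γ
      rw [mul_apply, Finset.sum_eq_single γ]
      · simp [one_apply, sgn]
      · intro b _ hb; simp [one_apply, hb]
      · simp
    mul_assoc := fun a b c => by
      ext γ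
      simp only [mul_apply, Finset.mul_sum, Finset.sum_mul]
      rw [Finset.sum_comm]
      refine Finset.sum_congr rfl fun α _ => ?_
      rw [← sum_symmDiff α]
      refine Finset.sum_congr rfl fun δ _ => ?_
      rw [symmDiff_symmDiff_cancel_left]
      have h := sgn_assoc α δ γ
      have h3 : (α ∆ δ) ∆ γ = δ ∆ (α ∆ γ) := by rw [symmDiff_comm α δ, symmDiff_assoc]
      rw [h3] at h ⊢
      linear_combination (a α * b δ * c (δ ∆ (α ∆ γ))) * h }

theorem e_mul_e (α β : Finset (Fin n)) : e α * e β = sgn α β • e (α ∆ β) := by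
  ext γ
  rw [mul_apply, Finset.sum_eq_single α]
  · simp only [e, smul_apply]
    by_cases h : γ = α ∆ β
    · subst h; simp
    · have : ¬ α ∆ γ = β := fun h' => h (by rw [← h', symmDiff_symmDiff_cancel_left])
      simp [h, this]
  · intro b _ hb; simp [e, hb]
  · simp

/-- The generators satisfy `e_i ^ 2 = -1`. -/
theorem e_single_sq (i : Fin n) : e {i} * e {i} = -1 := by
  rw [e_mul_e]
  simp only [sgn, Finset.prod_singleton, le_refl, if_true, symmDiff_self]
  exact neg_one_smul ℝ (1 : Cl n)

/-- Distinct generators anticommute. -/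
theorem e_single_anticomm {i j : Fin n} (h : i ≠ j) : e {i} * e {j} = -(e {j} * e {i}) := by
  rw [e_mul_e, e_mul_e, symmDiff_comm ({j} : Finset (Fin n)) {i}, ← neg_smul]
  congr 1
  simp only [sgn, Finset.prod_singleton]
  rcases lt_or_gt_of_ne h with h | h
  · simp [h.le, not_le.2 h]
  · simp [h.le, not_le.2 h]

/-- Clifford conjugation: `conj e_i = -e_i`, `conj (a * b) = conj b * conj a`, that is,
`conj e_α = (-1) ^ (k (k + 1) / 2) e_α` for `α` with `k` elements. -/
def conj (a : Cl n) : Cl n := fun α => (-1) ^ (α.card * (α.card + 1) / 2) * a α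

/-- The real part, the coefficient of `e_∅ = 1`. -/
def re (a : Cl n) : ℝ := a ∅

/-- `|a|`, the Euclidean length of the coefficient vector. -/
def abs (a : Cl n) : ℝ := √(∑ α, a α ^ 2)

/-- The paravectors `s_0 + s_1 e_1 + … + s_n e_n`, i.e. the copy of `ℝ^(n+1)` in `ℝ_n`. -/
def paravectors (n : ℕ) : Set (Cl n) := {a | ∀ α : Finset (Fin n), 1 < α.card → a α = 0}

/-- The sphere `𝕊` of purely imaginary paravectors of length one. -/
def unitSphere (n : ℕ) : Set (Cl n) := {a | a ∈ paravectors n ∧ a.re = 0 ∧ a.abs = 1}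

/-- The embedding `u + v i ↦ u + v 𝔧` of `ℂ` onto the plane `ℂ_𝔧 = ℝ + ℝ 𝔧`. -/
def slice (𝔧 : Cl n) (z : ℂ) : Cl n := z.re • (1 : Cl n) + z.im • 𝔧

/-- The closed upper half plane `ℂ_𝔧⁺ = {u + v 𝔧 : v ≥ 0}`. -/
def upperHalf (𝔧 : Cl n) : Set (Cl n) := slice 𝔧 '' {z : ℂ | 0 ≤ z.im}

theorem sgn_self (α : Finset (Fin n)) : (-1 : ℝ) ^ (α.card * (α.card + 1) / 2) * sgn α α = 1 := by
  induction α using Finset.induction_on_max with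
  | empty => simp [sgn]
  | insert a s ha ih =>
    have hs : a ∉ s := fun h => lt_irrefl _ (ha a h)
    have h1 : sgn (insert a s) (insert a s) = (-1) ^ (s.card + 1) * sgn s s := by
      have h2 : ∀ i ∈ s, (∏ j ∈ insert a s, if j ≤ i then (-1 : ℝ) else 1)
          = ∏ j ∈ s, if j ≤ i then (-1 : ℝ) else 1 := fun i hi => by
        rw [Finset.prod_insert hs, if_neg (not_le.2 (ha i hi)), one_mul]
      unfold sgn
      rw [Finset.prod_insert hs, Finset.prod_congr rfl h2, Finset.prod_insert hs, if_pos le_rfl,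
        Finset.prod_congr rfl (fun j hj => if_pos (ha j hj).le), Finset.prod_const]
      ring
    have h3 : (s.card + 1) * (s.card + 1 + 1) / 2 = s.card * (s.card + 1) / 2 + (s.card + 1) := by
      rw [show (s.card + 1) * (s.card + 1 + 1) = s.card * (s.card + 1) + (s.card + 1) * 2 by ring,
        Nat.add_mul_div_right _ _ two_pos]
    rw [Finset.card_insert_of_notMem hs, h1, h3, pow_add]
    have h4 : (-1 : ℝ) ^ (s.card + 1) * (-1) ^ (s.card + 1) = 1 := by
      rw [← mul_pow]; norm_num
    linear_combination ((-1 : ℝ) ^ (s.card + 1) * (-1) ^ (s.card + 1)) * ih + h4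

theorem conj_e_mul_e_empty (α β : Finset (Fin n)) :
    (conj (e β) * e α) ∅ = if α = β then 1 else 0 := by
  have h : conj (e β) = (-1 : ℝ) ^ (β.card * (β.card + 1) / 2) • e β := by
    ext γ
    by_cases h : γ = β
    · subst h; rfl
    · simp [conj, e, smul_apply, h]
  have h2 : (conj (e β) * e α) ∅ = (-1 : ℝ) ^ (β.card * (β.card + 1) / 2) * (e β * e α) ∅ := by
    rw [h, mul_apply, mul_apply, Finset.mul_sum]
    refine Finset.sum_congr rfl fun γ _ => ?_
    rw [smul_apply]; ring
  rw [h2, e_mul_e, smul_apply]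
  by_cases hab : α = β
  · subst hab; rw [← mul_assoc, sgn_self]; simp [e]
  · have : ¬ (∅ : Finset (Fin n)) = β ∆ α := fun h' =>
      hab (symmDiff_eq_bot.1 h'.symm).symm
    simp [e, this, hab]

end Cl

/-! ### The Clifford module `H_n = H ⊗ ℝ_n` -/

/-- The Clifford module `H_n` over the real Hilbert space `H`: vectors `x = ∑ α, x α ⊗ e_α`,
with norm `‖x‖ = (∑ α, ‖x α‖ ^ 2) ^ (1 / 2)`. -/
def CliffordModule (n : ℕ) (H : Type*) : Type _ := PiLp 2 fun _ : Finset (Fin n) => H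

namespace CliffordModule

variable {n : ℕ} {H : Type*} [NormedAddCommGroup H] [InnerProductSpace ℝ H]

instance : NormedAddCommGroup (CliffordModule n H) :=
  inferInstanceAs (NormedAddCommGroup (PiLp 2 fun _ : Finset (Fin n) => H))
instance : InnerProductSpace ℝ (CliffordModule n H) :=
  inferInstanceAs (InnerProductSpace ℝ (PiLp 2 fun _ : Finset (Fin n) => H))
instance [CompleteSpace H] : CompleteSpace (CliffordModule n H) :=
  inferInstanceAs (CompleteSpace (PiLp 2 fun _ : Finset (Fin n) => H))

/-- The coefficient `x_α` of `x = ∑ α, x_α ⊗ e_α`, as a bounded real linear map. -/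
def coord (α : Finset (Fin n)) : CliffordModule n H →L[ℝ] H :=
  PiLp.proj 2 (fun _ : Finset (Fin n) => H) α

/-- The vector `∑ α, v α ⊗ e_α`. -/
def mk (v : Finset (Fin n) → H) : CliffordModule n H := WithLp.toLp 2 v

@[simp] theorem coord_mk (v : Finset (Fin n) → H) (α : Finset (Fin n)) : coord α (mk v) = v α := rfl

@[ext] theorem ext {x y : CliffordModule n H} (h : ∀ α, coord α x = coord α y) : x = y :=
  PiLp.ext h

theorem inner_eq (x y : CliffordModule n H) :
    inner ℝ x y = ∑ α, inner ℝ (coord α x) (coord α y) := PiLp.inner_apply x y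


/-- Right multiplication `x a = ∑ α β, (a_β • x_α) ⊗ (e_α e_β)`. -/
instance : SMul (Cl n)ᵐᵒᵖ (CliffordModule n H) :=
  ⟨fun a x => mk fun γ => ∑ α, (sgn α (α ∆ γ) * a.unop (α ∆ γ)) • coord α x⟩

theorem coord_op_smul (a : (Cl n)ᵐᵒᵖ) (x : CliffordModule n H) (γ : Finset (Fin n)) :
    coord γ (a • x) = ∑ α, (sgn α (α ∆ γ) * a.unop (α ∆ γ)) • coord α x := rfl

/-- `H_n` is a right module over `ℝ_n`: `MulOpposite.op a • x` is `x a`. -/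
instance : Module (Cl n)ᵐᵒᵖ (CliffordModule n H) where
  one_smul x := by
    ext γ
    rw [coord_op_smul, Finset.sum_eq_single γ]
    · simp [Cl.one_apply, sgn]
    · intro α _ hα
      have h : α ∆ γ ≠ ∅ := fun h => hα (symmDiff_eq_bot.1 h)
      simp [h, Cl.one_apply]
    · simp
  mul_smul a b x := by
    ext γ
    simp only [coord_op_smul, MulOpposite.unop_mul, Cl.mul_apply, Finset.smul_sum, smul_smul,
      Finset.mul_sum, Finset.sum_smul]
    conv_rhs => rw [Finset.sum_comm]
    refine Finset.sum_congr rfl fun α _ => ?_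
    conv_rhs => rw [← Cl.sum_symmDiff α]
    refine Finset.sum_congr rfl fun δ _ => ?_
    rw [symmDiff_symmDiff_cancel_left]
    have h := Cl.sgn_assoc α δ γ
    have h3 : (α ∆ δ) ∆ γ = δ ∆ (α ∆ γ) := by rw [symmDiff_comm α δ, symmDiff_assoc]
    rw [h3] at h ⊢
    congr 1
    linear_combination (-(b.unop δ * a.unop (δ ∆ (α ∆ γ)))) * h
  smul_zero a := by ext γ; simp [coord_op_smul]
  zero_smul x := by ext γ; simp [coord_op_smul, Cl.zero_apply]
  smul_add a x y := by ext γ; simp [coord_op_smul, Finset.sum_add_distrib]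
  add_smul a b x := by
    ext γ; simp [coord_op_smul, Cl.add_apply, mul_add, add_smul, Finset.sum_add_distrib]

instance : SMulCommClass (Cl n)ᵐᵒᵖ ℝ (CliffordModule n H) :=
  ⟨fun a c x => by
    ext γ
    simp only [coord_op_smul, map_smul, Finset.smul_sum]
    exact Finset.sum_congr rfl fun α _ => smul_comm _ _ _⟩

instance : SMulCommClass ℝ (Cl n)ᵐᵒᵖ (CliffordModule n H) :=
  SMulCommClass.symm (Cl n)ᵐᵒᵖ ℝ (CliffordModule n H)

instance : ContinuousConstSMul (Cl n)ᵐᵒᵖ (CliffordModule n H) :=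
  ⟨fun _ => (PiLp.continuous_toLp 2 _).comp <| continuous_pi fun _ =>
    continuous_finsetSum _ fun α _ =>
      (coord (n := n) (H := H) α).continuous.const_smul _⟩

/-- Right multiplication by the Clifford number `a` as a bounded real linear map. -/
def rightMul (a : (Cl n)ᵐᵒᵖ) : CliffordModule n H →L[ℝ] CliffordModule n H where
  toFun x := a • x
  map_add' := smul_add a
  map_smul' c x := smul_comm a c x
  cont := continuous_const_smul a

theorem op_real_smul (r : ℝ) (x : CliffordModule n H) :
    MulOpposite.op (r • (1 : Cl n)) • x = r • x := by
  ext γ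
  rw [coord_op_smul, Finset.sum_eq_single γ]
  · simp [Cl.smul_apply, Cl.one_apply, sgn]
  · intro α _ hα
    have h : α ∆ γ ≠ ∅ := fun h => hα (symmDiff_eq_bot.1 h)
    simp [h, Cl.smul_apply, Cl.one_apply]
  · simp

/-- The `ℝ_n`-valued inner product, right linear in the first variable:
`⟨x a, y⟩ = ⟨x, y⟩ a` and `⟨x, y a⟩ = conj a ⟨x, y⟩`. -/
def cinner (x y : CliffordModule n H) : Cl n :=
  ∑ α, ∑ β, inner ℝ (coord α x) (coord β y) • (Cl.conj (Cl.e β) * Cl.e α)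

theorem re_cinner (x y : CliffordModule n H) : (cinner x y).re = inner ℝ x y := by
  let ev : Cl n →+ ℝ := ⟨⟨fun a => a ∅, rfl⟩, fun _ _ => rfl⟩
  have h : (cinner x y).re = ev (cinner x y) := rfl
  rw [h, cinner, inner_eq, map_sum]
  refine Finset.sum_congr rfl fun α _ => ?_
  rw [map_sum, Finset.sum_eq_single α]
  · change _ * (Cl.conj (Cl.e α) * Cl.e α) ∅ = _
    rw [Cl.conj_e_mul_e_empty, if_pos rfl, mul_one]
  · intro β _ hβ
    change _ * (Cl.conj (Cl.e β) * Cl.e α) ∅ = _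
    rw [Cl.conj_e_mul_e_empty, if_neg (Ne.symm hβ), mul_zero]
  · simp

end CliffordModule

/-! ### Right linear operators -/

section Operators

open CliffordModule

/-- The bounded right linear operators `B(H_n)`. -/
abbrev BoundedOp (n : ℕ) (H : Type*) [NormedAddCommGroup H] [InnerProductSpace ℝ H] : Type _ :=
  CliffordModule n H →L[(Cl n)ᵐᵒᵖ] CliffordModule n H

/-- The right linear operators `L(H_n)`, defined on a right submodule of `H_n`. -/
abbrev PartialOp (n : ℕ) (H : Type*) [NormedAddCommGroup H] [InnerProductSpace ℝ H] : Type _ :=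
  CliffordModule n H →ₗ.[(Cl n)ᵐᵒᵖ] CliffordModule n H

variable {n : ℕ} {H : Type*} [NormedAddCommGroup H] [InnerProductSpace ℝ H]

theorem map_real_smul (A : BoundedOp n H) (r : ℝ) (x : CliffordModule n H) :
    A (r • x) = r • A x := by
  rw [← op_real_smul, map_smul, op_real_smul]

/-- `B` is the adjoint of `A`. -/
def IsAdjoint (A B : BoundedOp n H) : Prop := ∀ x y, cinner (A x) y = cinner x (B y)

/-- Orthogonal projections: `P* = P` and `P² = P`. -/
def IsOrthogonalProjection (P : BoundedOp n H) : Prop := IsAdjoint P P ∧ P * P = P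

/-- Imaginary operators: `J* = -J` and `J J* = J* J = 1`. -/
def IsImaginary (J : BoundedOp n H) : Prop := IsAdjoint J (-J) ∧ J * (-J) = 1 ∧ (-J) * J = 1

/-- Convergence `A_j → A` in the operator norm. -/
def TendstoOpNorm (A : ℕ → BoundedOp n H) (B : BoundedOp n H) : Prop :=
  ∀ ε : ℝ, 0 < ε → ∃ N, ∀ j ≥ N, ∀ x, ‖A j x - B x‖ ≤ ε * ‖x‖

/-- `Q_s(T) x = T² x - 2 Re(s) T x + |s|² x` for `x` in the domain of `T²`, that is,
`x ∈ D(T)` with `T x ∈ D(T)`. -/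
def Q (T : PartialOp n H) (s : Cl n) (x : T.domain) (hx : T x ∈ T.domain) : CliffordModule n H :=
  T ⟨T x, hx⟩ - (2 * s.re) • T x + s.abs ^ 2 • (x : CliffordModule n H)

/-- The `S`-resolvent set: the paravectors `s` such that `Q_s(T)` has trivial kernel and dense
range and its inverse, defined on the range, is bounded. -/
def sResolventSet (T : PartialOp n H) : Set (Cl n) :=
  {s | s ∈ Cl.paravectors n ∧
    (∀ (x : T.domain) (hx : T x ∈ T.domain), Q T s x hx = 0 → x = 0) ∧
    Dense {y | ∃ (x : T.domain) (hx : T x ∈ T.domain), Q T s x hx = y} ∧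
    ∃ C : ℝ, ∀ (x : T.domain) (hx : T x ∈ T.domain),
      ‖(x : CliffordModule n H)‖ ≤ C * ‖Q T s x hx‖}

/-- The `S`-spectrum. -/
def sSpectrum (T : PartialOp n H) : Set (Cl n) := Cl.paravectors n \ sResolventSet T

theorem IsAdjoint.inner_eq {A B : BoundedOp n H} (h : IsAdjoint A B) (x y : CliffordModule n H) :
    inner ℝ (A x) y = inner ℝ x (B y) := by
  rw [← re_cinner, ← re_cinner, h]

theorem IsImaginary.norm_eq {J : BoundedOp n H} (h : IsImaginary J) (x : CliffordModule n H) :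
    ‖J x‖ = ‖x‖ := by
  have h1 : inner ℝ (J x) (J x) = inner ℝ x x := by
    rw [h.1.inner_eq, ← mul_apply_eq_comp, h.2.2]; rfl
  rw [real_inner_self_eq_norm_sq, real_inner_self_eq_norm_sq] at h1
  exact (sq_eq_sq₀ (norm_nonneg _) (norm_nonneg _)).1 h1

end Operators

/-! ### Spectral measures -/

section SpectralMeasure

open CliffordModule

/-- A spectral measure on the measurable space `Ω` with values in the orthogonal projections of
`H_n`, countably additive in the strong operator topology; only the values on measurable sets are
meaningful. -/
structure SpectralMeasure (n : ℕ) (H : Type*) [NormedAddCommGroup H] [InnerProductSpace ℝ H]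
    (Ω : Type*) [MeasurableSpace Ω] where
  /-- The projection attached to a set. -/
  toFun : Set Ω → BoundedOp n H
  proj : ∀ M, MeasurableSet M → IsOrthogonalProjection (toFun M)
  iUnion : ∀ M : ℕ → Set Ω, (∀ i, MeasurableSet (M i)) → Pairwise (Function.onFun Disjoint M) →
    ∀ x, Tendsto (fun k => ∑ i ∈ Finset.range k, toFun (M i) x) atTop (𝓝 (toFun (⋃ i, M i) x))
  univ : toFun Set.univ = 1

variable {n : ℕ} {H : Type*} [NormedAddCommGroup H] [InnerProductSpace ℝ H]
  {Ω : Type*} [MeasurableSpace Ω]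

namespace SpectralMeasure

instance : CoeFun (SpectralMeasure n H Ω) fun _ => Set Ω → BoundedOp n H := ⟨toFun⟩

variable (E : SpectralMeasure n H Ω)

theorem apply_apply {M : Set Ω} (hM : MeasurableSet M) (x : CliffordModule n H) :
    E M (E M x) = E M x := by
  rw [← mul_apply_eq_comp, (E.proj M hM).2]

theorem inner_eq {M : Set Ω} (hM : MeasurableSet M) (x y : CliffordModule n H) :
    inner ℝ (E M x) y = inner ℝ x (E M y) := (E.proj M hM).1.inner_eq x y

theorem re_cinner_eq {M : Set Ω} (hM : MeasurableSet M) (x : CliffordModule n H) :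
    (cinner (E M x) x).re = ‖E M x‖ ^ 2 := by
  rw [re_cinner, ← real_inner_self_eq_norm_sq, E.inner_eq hM x (E M x), E.apply_apply hM,
    E.inner_eq hM]

theorem empty : E ∅ = 0 := by
  ext1 x
  have h := E.iUnion (fun _ => ∅) (fun _ => MeasurableSet.empty)
    (fun i j _ => disjoint_bot_left) x
  simp only [Set.iUnion_empty, Finset.sum_const, Finset.card_range] at h
  have h1 := (h.comp (tendsto_add_atTop_nat 1)).sub h
  simp only [Function.comp_def, add_smul, one_smul, add_sub_cancel_left, sub_self] at h1
  exact tendsto_nhds_unique tendsto_const_nhds h1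

theorem union {M N : Set Ω} (hM : MeasurableSet M) (hN : MeasurableSet N) (h : Disjoint M N) :
    E (M ∪ N) = E M + E N := by
  ext1 x
  let S : ℕ → Set Ω := fun i => if i = 0 then M else if i = 1 then N else ∅
  have hS : ⋃ i, S i = M ∪ N := by
    ext p
    simp only [Set.mem_iUnion, Set.mem_union]
    constructor
    · rintro ⟨i, hi⟩
      simp only [S] at hi
      split_ifs at hi
      · exact Or.inl hi
      · exact Or.inr hi
      · exact hi.elim
    · rintro (h | h)
      · exact ⟨0, by simpa [S] using h⟩
      · exact ⟨1, by simpa [S] using h⟩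
  have h1 := E.iUnion S (fun i => by simp only [S]; split_ifs <;> simp [hM, hN])
    (fun i j hij => by
      simp only [Function.onFun, S]
      split_ifs <;> first | (exfalso; omega) | simp [h, h.symm]) x
  rw [hS] at h1
  refine tendsto_nhds_unique h1 (tendsto_const_nhds.congr' ?_)
  filter_upwards [eventually_ge_atTop 2] with k hk
  rw [← Finset.sum_subset (Finset.range_subset_range.2 hk)]
  · simp [Finset.sum_range_succ, S]
  · intro i _ hi
    have : 2 ≤ i := not_lt.1 fun h => hi (Finset.mem_range.2 h)
    simp [S, show i ≠ 0 by omega, show i ≠ 1 by omega, E.empty]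

theorem mul_eq_zero {M N : Set Ω} (hM : MeasurableSet M) (hN : MeasurableSet N)
    (h : Disjoint M N) (x : CliffordModule n H) : E M (E N x) = 0 := by
  have h1 := E.re_cinner_eq (hM.union hN) (E N x)
  have h2 := E.re_cinner_eq hM (E N x)
  have h3 := E.re_cinner_eq hN (E N x)
  rw [re_cinner, E.union hM hN h, add_apply, inner_add_left, ← re_cinner,
    ← re_cinner, h2, h3, E.apply_apply hN] at h1
  have h4 : inner ℝ (E M (E N x)) (E N x) = ‖E M (E N x)‖ ^ 2 := by rw [← re_cinner, h2]
  rw [norm_add_sq_real, h4] at h1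
  have h5 : ‖E M (E N x)‖ ^ 2 = 0 := by linarith [sq_nonneg ‖E M (E N x)‖]
  exact norm_eq_zero.1 (pow_eq_zero_iff two_ne_zero |>.1 h5)

/-- The positive measure `M ↦ Re ⟨E(M) x, x⟩`. -/
def reMeasure (x : CliffordModule n H) : Measure Ω :=
  Measure.ofMeasurable (fun M _ => ENNReal.ofReal (cinner (E M x) x).re)
    (by simp [re_cinner, E.empty])
    (by
      intro M hM hd
      have h1 : Tendsto (fun k => ∑ i ∈ Finset.range k, (cinner (E (M i) x) x).re) atTop
          (𝓝 (cinner (E (⋃ i, M i) x) x).re) := by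
        simp only [re_cinner, ← sum_inner]
        exact (E.iUnion M hM hd x).inner tendsto_const_nhds
      have h0 : ∀ i, 0 ≤ (cinner (E (M i) x) x).re := fun i => by
        rw [E.re_cinner_eq (hM i)]; positivity
      have h2 : HasSum (fun i => (cinner (E (M i) x) x).re) (cinner (E (⋃ i, M i) x) x).re :=
        (hasSum_iff_tendsto_nat_of_nonneg h0 _).2 h1
      rw [← h2.tsum_eq, ENNReal.ofReal_tsum_of_nonneg h0 h2.summable])

theorem reMeasure_apply (x : CliffordModule n H) {M : Set Ω} (hM : MeasurableSet M) :
    E.reMeasure x M = ENNReal.ofReal (‖E M x‖ ^ 2) := by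
  rw [reMeasure, Measure.ofMeasurable_apply M hM, E.re_cinner_eq hM]

instance (x : CliffordModule n H) : IsFiniteMeasure (E.reMeasure x) :=
  ⟨by rw [E.reMeasure_apply x MeasurableSet.univ]; exact ENNReal.ofReal_lt_top⟩

theorem reMeasure_real (x : CliffordModule n H) {M : Set Ω} (hM : MeasurableSet M) :
    (E.reMeasure x).real M = ‖E M x‖ ^ 2 := by
  rw [Measure.real, E.reMeasure_apply x hM, ENNReal.toReal_ofReal (by positivity)]

theorem reMeasure_add_le (x y : CliffordModule n H) :
    E.reMeasure (x + y) ≤ (2 : ℝ≥0∞) • (E.reMeasure x + E.reMeasure y) := by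
  refine Measure.le_iff.2 fun M hM => ?_
  rw [Measure.smul_apply, Measure.add_apply, E.reMeasure_apply _ hM, E.reMeasure_apply _ hM,
    E.reMeasure_apply _ hM, ← ENNReal.ofReal_add (by positivity) (by positivity), smul_eq_mul,
    ← ENNReal.ofReal_ofNat, ← ENNReal.ofReal_mul (by norm_num)]
  refine ENNReal.ofReal_le_ofReal ?_
  rw [map_add]
  have h1 := norm_add_le (E M x) (E M y)
  nlinarith [sq_nonneg (‖E M x‖ - ‖E M y‖), norm_nonneg (E M x + E M y)]

theorem reMeasure_smul_le (a : (Cl n)ᵐᵒᵖ) (x : CliffordModule n H) :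
    E.reMeasure (a • x) ≤ ENNReal.ofReal (‖rightMul (H := H) a‖ ^ 2) • E.reMeasure x := by
  refine Measure.le_iff.2 fun M hM => ?_
  rw [Measure.smul_apply, E.reMeasure_apply _ hM, E.reMeasure_apply _ hM, smul_eq_mul,
    ← ENNReal.ofReal_mul (by positivity), ← mul_pow]
  refine ENNReal.ofReal_le_ofReal ?_
  rw [map_smul]
  exact pow_le_pow_left₀ (norm_nonneg _) ((rightMul a).le_opNorm (E M x)) 2

/-! ### Spectral integrals of simple functions -/

/-- `J` is associated with the spectral measure `E`: an imaginary operator commuting with `E`. -/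
structure IsAssociated (J : BoundedOp n H) : Prop where
  imaginary : IsImaginary J
  comm : ∀ M, MeasurableSet M → J * E M = E M * J

/-- `𝕀(φ) = ∑ c, (Re c • E(φ = c) + Im c • E(φ = c) J)` for a simple function `φ`; here and below
`c = u + v i` stands for the element `u + v 𝔧` of the plane `ℂ_𝔧`. -/
def simpleIntegral (J : BoundedOp n H) (φ : SimpleFunc Ω ℂ) : BoundedOp n H :=
  ∑ c ∈ φ.range, (c.re • E (φ ⁻¹' {c}) + c.im • (E (φ ⁻¹' {c}) * J))

variable {E} {J : BoundedOp n H}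

/-- The operator `Re c + Im c J` followed by `E M`, as a real linear function of `c`. -/
def weight (E : SpectralMeasure n H Ω) (J : BoundedOp n H) (x : CliffordModule n H) (M : Set Ω) :
    ℂ →L[ℝ] CliffordModule n H :=
  Complex.reCLM.smulRight (E M x) + Complex.imCLM.smulRight (E M (J x))

theorem weight_finMeasAdditive (x : CliffordModule n H) :
    FinMeasAdditive (0 : Measure Ω) (weight E J x) := by
  intro M N hM hN _ _ h
  ext1 c
  simp [weight, E.union hM hN h]
  abel

theorem simpleIntegral_apply (φ : SimpleFunc Ω ℂ) (x : CliffordModule n H) :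
    E.simpleIntegral J φ x = φ.setToSimpleFunc (weight E J x) := by
  simp [simpleIntegral, SimpleFunc.setToSimpleFunc, weight]

theorem simpleIntegral_sub (φ ψ : SimpleFunc Ω ℂ) (x : CliffordModule n H) :
    E.simpleIntegral J (φ - ψ) x = E.simpleIntegral J φ x - E.simpleIntegral J ψ x := by
  rw [simpleIntegral_apply, simpleIntegral_apply, simpleIntegral_apply]
  exact SimpleFunc.setToSimpleFunc_sub _ (weight_finMeasAdditive x)
    (by simp) (by simp)

theorem norm_simpleIntegral_sq (hJ : E.IsAssociated J) (φ : SimpleFunc Ω ℂ)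
    (x : CliffordModule n H) :
    ‖E.simpleIntegral J φ x‖ ^ 2 = ∫ p, ‖φ p‖ ^ 2 ∂(E.reMeasure x) := by
  have hm : ∀ c, MeasurableSet (φ ⁻¹' {c}) := fun c => φ.measurableSet_preimage _
  have h1 : E.simpleIntegral J φ x
      = ∑ c ∈ φ.range, E (φ ⁻¹' {c}) (c.re • x + c.im • J x) := by
    simp [simpleIntegral, map_real_smul]
  have h2 : ∀ c : ℂ, ‖E (φ ⁻¹' {c}) (c.re • x + c.im • J x)‖ ^ 2
      = ‖c‖ ^ 2 * ‖E (φ ⁻¹' {c}) x‖ ^ 2 := by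
    intro c
    set y := E (φ ⁻¹' {c}) x with hy
    have hJy : E (φ ⁻¹' {c}) (J x) = J y := by
      rw [hy, ← mul_apply_eq_comp, ← mul_apply_eq_comp, hJ.comm _ (hm c)]
    have h3 : inner ℝ y (J y) = 0 := by
      have := hJ.imaginary.1.inner_eq y y
      simp only [neg_apply, inner_neg_right] at this
      rw [real_inner_comm] at this
      linarith
    rw [map_add, map_real_smul, map_real_smul, ← hy, hJy, norm_add_sq_real, inner_smul_left, inner_smul_right, h3,
      norm_smul, norm_smul, hJ.imaginary.norm_eq, ← Complex.normSq_eq_norm_sq,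
      Complex.normSq_apply, mul_pow, mul_pow, Real.norm_eq_abs, Real.norm_eq_abs, sq_abs, sq_abs]
    ring
  have h5 : ‖E.simpleIntegral J φ x‖ ^ 2
      = ∑ c ∈ φ.range, ‖E (φ ⁻¹' {c}) (c.re • x + c.im • J x)‖ ^ 2 := by
    rw [h1, ← real_inner_self_eq_norm_sq, sum_inner]
    refine Finset.sum_congr rfl fun c hc => ?_
    rw [inner_sum, Finset.sum_eq_single c, real_inner_self_eq_norm_sq]
    · intro d _ hd
      rw [E.inner_eq (hm c), E.mul_eq_zero (hm c) (hm d), inner_zero_right]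
      exact Disjoint.preimage _ (Set.disjoint_singleton.2 hd.symm)
    · exact fun h => (h hc).elim
  rw [h5, Finset.sum_congr rfl fun c _ => h2 c]
  have h6 : ∫ p, ‖φ p‖ ^ 2 ∂(E.reMeasure x) = ∫ p, (φ.map fun c : ℂ => ‖c‖ ^ 2) p ∂(E.reMeasure x) :=
    rfl
  rw [h6, ← SimpleFunc.integral_eq_integral _ (SimpleFunc.integrable_of_isFiniteMeasure _),
    SimpleFunc.map_integral _ _ (SimpleFunc.integrable_of_isFiniteMeasure _) (by simp)]
  refine Finset.sum_congr rfl fun c _ => ?_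
  rw [E.reMeasure_real x (hm c), smul_eq_mul, mul_comm]

/-! ### Spectral integrals of bounded measurable functions -/

theorem norm_simpleIntegral_sub_le (hJ : E.IsAssociated J) {φ ψ : SimpleFunc Ω ℂ} {ε : ℝ}
    (hε : 0 ≤ ε) (h : ∀ p, ‖φ p - ψ p‖ ≤ ε) (x : CliffordModule n H) :
    ‖E.simpleIntegral J φ x - E.simpleIntegral J ψ x‖ ≤ ε * ‖x‖ := by
  rw [← simpleIntegral_sub]
  refine (sq_le_sq₀ (norm_nonneg _) (by positivity)).1 ?_
  rw [norm_simpleIntegral_sq hJ]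
  calc ∫ p, ‖(φ - ψ) p‖ ^ 2 ∂(E.reMeasure x) ≤ ∫ _, ε ^ 2 ∂(E.reMeasure x) := by
        refine integral_mono_of_nonneg (Eventually.of_forall fun p => by positivity)
          (integrable_const _) (Eventually.of_forall fun p => ?_)
        exact pow_le_pow_left₀ (norm_nonneg _) (h p) 2
    _ = (ε * ‖x‖) ^ 2 := by
        rw [integral_const, E.reMeasure_real x MeasurableSet.univ, E.univ, smul_eq_mul]
        change ‖x‖ ^ 2 * ε ^ 2 = _
        ring

theorem norm_simpleIntegral_le (hJ : E.IsAssociated J) {φ : SimpleFunc Ω ℂ} {C : ℝ}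
    (hC : 0 ≤ C) (h : ∀ p, ‖φ p‖ ≤ C) (x : CliffordModule n H) :
    ‖E.simpleIntegral J φ x‖ ≤ C * ‖x‖ := by
  have h0 : E.simpleIntegral J 0 x = 0 := by
    have := simpleIntegral_sub (E := E) (J := J) 0 0 x
    rwa [sub_self, sub_self] at this
  have := norm_simpleIntegral_sub_le hJ (φ := φ) (ψ := 0) hC (fun p => by simpa using h p) x
  rwa [h0, sub_zero] at this

/-- A bounded measurable function is a uniform limit of simple functions. -/
theorem exists_simple_approx {g : Ω → ℂ} (hg : Measurable g) (hb : ∃ C, ∀ p, ‖g p‖ ≤ C) :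
    ∃ φ : ℕ → SimpleFunc Ω ℂ, TendstoUniformly (fun j => ⇑(φ j)) g atTop := by
  obtain ⟨C, hC⟩ := hb
  let r : ℕ → ℝ → ℝ := fun j t => (⌊(j + 1 : ℝ) * t⌋ : ℝ) / (j + 1)
  have hr : ∀ j, Measurable (r j) := fun j => by
    have : Measurable fun t : ℝ => ((⌊(j + 1 : ℝ) * t⌋ : ℤ) : ℝ) :=
      (measurable_from_top (f := fun k : ℤ => (k : ℝ))).comp
        (Int.measurable_floor.comp (measurable_const.mul measurable_id))
    exact this.div_const _
  have hr1 : ∀ j t, |r j t - t| ≤ 1 / (j + 1) := fun j t => by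
    have hj : (0 : ℝ) < j + 1 := by positivity
    have h1 := Int.floor_le ((j + 1 : ℝ) * t)
    have h2 := Int.lt_floor_add_one ((j + 1 : ℝ) * t)
    have h3 : r j t - t = ((⌊(j + 1 : ℝ) * t⌋ : ℝ) - (j + 1) * t) / (j + 1) := by
      simp only [r]; field_simp
    rw [h3, abs_div, abs_of_pos hj]
    exact div_le_div_of_nonneg_right (abs_le.2 ⟨by linarith, by linarith⟩) hj.le
  have hfin : ∀ j, (Set.range fun p => (⟨r j (g p).re, r j (g p).im⟩ : ℂ)).Finite := fun j => by
    let a : ℤ := ⌊(j + 1 : ℝ) * (-C)⌋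
    let b : ℤ := ⌊(j + 1 : ℝ) * C⌋
    have hj : (0 : ℝ) ≤ j + 1 := by positivity
    refine (((Set.finite_Icc a b).prod (Set.finite_Icc a b)).image
      fun k : ℤ × ℤ => (⟨k.1 / (j + 1), k.2 / (j + 1)⟩ : ℂ)).subset ?_
    rintro _ ⟨p, rfl⟩
    have h1 := abs_le.1 ((Complex.abs_re_le_norm _).trans (hC p))
    have h2 := abs_le.1 ((Complex.abs_im_le_norm _).trans (hC p))
    exact ⟨(⌊(j + 1 : ℝ) * (g p).re⌋, ⌊(j + 1 : ℝ) * (g p).im⌋),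
      ⟨⟨Int.floor_le_floor (mul_le_mul_of_nonneg_left h1.1 hj),
        Int.floor_le_floor (mul_le_mul_of_nonneg_left h1.2 hj)⟩,
       ⟨Int.floor_le_floor (mul_le_mul_of_nonneg_left h2.1 hj),
        Int.floor_le_floor (mul_le_mul_of_nonneg_left h2.2 hj)⟩⟩, rfl⟩
  have hm : ∀ j, Measurable fun p => (⟨r j (g p).re, r j (g p).im⟩ : ℂ) := fun j =>
    Complex.measurableEquivRealProd.symm.measurable.comp
      (((hr j).comp (Complex.measurable_re.comp hg)).prodMk
        ((hr j).comp (Complex.measurable_im.comp hg)))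
  refine ⟨fun j => ⟨fun p => ⟨r j (g p).re, r j (g p).im⟩,
    fun c => hm j (measurableSet_singleton c), hfin j⟩, ?_⟩
  rw [Metric.tendstoUniformly_iff]
  intro ε hε
  obtain ⟨N, hN⟩ := exists_nat_gt (2 / ε)
  filter_upwards [eventually_ge_atTop N] with j hj p
  have hj' : (N : ℝ) ≤ j := by exact_mod_cast hj
  have hpos : (0 : ℝ) < j + 1 := by positivity
  rw [dist_comm, dist_eq_norm]
  refine (Complex.norm_le_abs_re_add_abs_im _).trans_lt ?_
  have h1 := hr1 j (g p).re
  have h2 := hr1 j (g p).im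
  have h3 : 2 / ((j : ℝ) + 1) < ε := by
    rw [div_lt_iff₀ hpos]
    rw [div_lt_iff₀ hε] at hN
    nlinarith
  calc |r j (g p).re - (g p).re| + |r j (g p).im - (g p).im|
      ≤ 1 / (j + 1) + 1 / (j + 1) := add_le_add h1 h2
    _ = 2 / ((j : ℝ) + 1) := by ring
    _ < ε := h3

theorem tendsto_of_tendstoOpNorm {A : ℕ → BoundedOp n H} {B : BoundedOp n H}
    (h : TendstoOpNorm A B) (x : CliffordModule n H) :
    Tendsto (fun j => A j x) atTop (𝓝 (B x)) := by
  rw [Metric.tendsto_atTop]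
  intro ε hε
  obtain ⟨N, hN⟩ := h (ε / (‖x‖ + 1)) (by positivity)
  refine ⟨N, fun j hj => ?_⟩
  rw [dist_eq_norm]
  refine (hN j hj x).trans_lt ?_
  rw [div_mul_eq_mul_div, div_lt_iff₀ (by positivity)]
  nlinarith [norm_nonneg x]

variable [CompleteSpace H]

/-- The integrals of simple functions converging uniformly to a bounded measurable function
converge in the operator norm, to a limit that does not depend on the approximation. -/
theorem exists_boundedIntegral (hJ : E.IsAssociated J) {g : Ω → ℂ} (hg : Measurable g)
    (hb : ∃ C, ∀ p, ‖g p‖ ≤ C) :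
    ∃ A : BoundedOp n H, ∀ φ : ℕ → SimpleFunc Ω ℂ, TendstoUniformly (fun j => ⇑(φ j)) g atTop →
      TendstoOpNorm (fun j => E.simpleIntegral J (φ j)) A := by
  obtain ⟨φ, hφ⟩ := exists_simple_approx hg hb
  have key : ∀ ψ : ℕ → SimpleFunc Ω ℂ, TendstoUniformly (fun j => ⇑(ψ j)) g atTop →
      ∀ ε : ℝ, 0 < ε → ∃ N, ∀ i ≥ N, ∀ j ≥ N, ∀ x,
        ‖E.simpleIntegral J (ψ i) x - E.simpleIntegral J (φ j) x‖ ≤ ε * ‖x‖ := by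
    intro ψ hψ ε hε
    obtain ⟨N, hN⟩ := eventually_atTop.1 (Metric.tendstoUniformly_iff.1 hψ (ε / 2) (by positivity))
    obtain ⟨N', hN'⟩ :=
      eventually_atTop.1 (Metric.tendstoUniformly_iff.1 hφ (ε / 2) (by positivity))
    refine ⟨max N N', fun i hi j hj x => norm_simpleIntegral_sub_le hJ hε.le (fun p => ?_) x⟩
    have h1 := hN i (le_trans (le_max_left _ _) hi) p
    have h2 := hN' j (le_trans (le_max_right _ _) hj) p
    rw [← dist_eq_norm]
    have := dist_triangle_left (ψ i p) (φ j p) (g p)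
    linarith
  have hlim : ∀ x, ∃ y, Tendsto (fun j => E.simpleIntegral J (φ j) x) atTop (𝓝 y) := fun x => by
    refine cauchySeq_tendsto_of_complete (Metric.cauchySeq_iff.2 fun ε hε => ?_)
    obtain ⟨N, hN⟩ := key φ hφ (ε / (‖x‖ + 1)) (by positivity)
    refine ⟨N, fun i hi j hj => ?_⟩
    rw [dist_eq_norm]
    refine (hN i hi j hj x).trans_lt ?_
    rw [div_mul_eq_mul_div, div_lt_iff₀ (by positivity)]
    nlinarith [norm_nonneg x]
  choose L hL using hlim
  have hclose : ∀ ψ : ℕ → SimpleFunc Ω ℂ, TendstoUniformly (fun j => ⇑(ψ j)) g atTop →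
      ∀ ε : ℝ, 0 < ε → ∃ N, ∀ i ≥ N, ∀ x, ‖E.simpleIntegral J (ψ i) x - L x‖ ≤ ε * ‖x‖ := by
    intro ψ hψ ε hε
    obtain ⟨N, hN⟩ := key ψ hψ ε hε
    refine ⟨N, fun i hi x => ?_⟩
    refine le_of_tendsto ((tendsto_const_nhds.sub (hL x)).norm) ?_
    filter_upwards [eventually_ge_atTop N] with j hj using hN i hi j hj x
  let A₀ : CliffordModule n H →ₗ[(Cl n)ᵐᵒᵖ] CliffordModule n H :=
    { toFun := L
      map_add' := fun x y => tendsto_nhds_unique (hL (x + y)) (by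
        simp only [map_add]; exact (hL x).add (hL y))
      map_smul' := fun a x => tendsto_nhds_unique (hL (a • x)) (by
        simp only [map_smul]; exact (hL x).const_smul a) }
  have hcont : Continuous A₀ := by
    obtain ⟨N, hN⟩ := hclose φ hφ 1 one_pos
    obtain ⟨K, hK⟩ := (φ N).exists_forall_norm_le
    have hK0 : 0 ≤ max K 0 := le_max_right _ _
    refine AddMonoidHomClass.continuous_of_bound A₀ (max K 0 + 1) fun x => ?_
    have h1 := hN N le_rfl x
    have h2 := norm_simpleIntegral_le hJ hK0 (fun p => (hK p).trans (le_max_left _ _)) x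
    have h3 := norm_sub_norm_le (L x) (E.simpleIntegral J (φ N) x)
    rw [norm_sub_rev] at h3
    change ‖L x‖ ≤ _
    linarith
  exact ⟨⟨A₀, hcont⟩, fun ψ hψ ε hε => hclose ψ hψ ε hε⟩

/-- `𝕀(g)` for a bounded measurable `g`: the operator norm limit of `𝕀(φ_j)` for simple functions
`φ_j` converging uniformly to `g`. -/
def boundedIntegral (hJ : E.IsAssociated J) (g : Ω → ℂ) (hg : Measurable g)
    (hb : ∃ C, ∀ p, ‖g p‖ ≤ C) : BoundedOp n H :=
  Classical.choose (exists_boundedIntegral hJ hg hb)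

theorem boundedIntegral_spec (hJ : E.IsAssociated J) {g : Ω → ℂ} (hg : Measurable g)
    (hb : ∃ C, ∀ p, ‖g p‖ ≤ C) (φ : ℕ → SimpleFunc Ω ℂ)
    (hφ : TendstoUniformly (fun j => ⇑(φ j)) g atTop) :
    TendstoOpNorm (fun j => E.simpleIntegral J (φ j)) (E.boundedIntegral hJ g hg hb) :=
  Classical.choose_spec (exists_boundedIntegral hJ hg hb) φ hφ

theorem norm_boundedIntegral_sub_sq (hJ : E.IsAssociated J) {g h : Ω → ℂ} (hg : Measurable g)
    (hgb : ∃ C, ∀ p, ‖g p‖ ≤ C) (hh : Measurable h) (hhb : ∃ C, ∀ p, ‖h p‖ ≤ C)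
    (x : CliffordModule n H) :
    ‖E.boundedIntegral hJ g hg hgb x - E.boundedIntegral hJ h hh hhb x‖ ^ 2
      = ∫ p, ‖g p - h p‖ ^ 2 ∂(E.reMeasure x) := by
  obtain ⟨φ, hφ⟩ := exists_simple_approx hg hgb
  obtain ⟨ψ, hψ⟩ := exists_simple_approx hh hhb
  have h1 := tendsto_of_tendstoOpNorm (boundedIntegral_spec hJ hg hgb φ hφ) x
  have h2 := tendsto_of_tendstoOpNorm (boundedIntegral_spec hJ hh hhb ψ hψ) x
  refine tendsto_nhds_unique ((h1.sub h2).norm.pow 2) ?_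
  simp only [← simpleIntegral_sub, norm_simpleIntegral_sq hJ]
  obtain ⟨C, hC⟩ := hgb
  obtain ⟨D, hD⟩ := hhb
  refine tendsto_integral_filter_of_dominated_convergence (fun _ => (C + D + 2) ^ 2) ?_ ?_ ?_ ?_
  · exact Eventually.of_forall fun j => ((φ j - ψ j).measurable.norm.pow_const 2).aestronglyMeasurable
  · filter_upwards [Metric.tendstoUniformly_iff.1 hφ 1 one_pos,
      Metric.tendstoUniformly_iff.1 hψ 1 one_pos] with j hj hj'
    refine Eventually.of_forall fun p => ?_
    have e1 := hj p
    have e2 := hj' p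
    rw [dist_comm, dist_eq_norm] at e1 e2
    have e3 : ‖(φ j - ψ j) p‖ ≤ C + D + 2 := by
      have e4 : (φ j - ψ j) p = (φ j p - g p) - (ψ j p - h p) + g p - h p := by
        simp only [SimpleFunc.coe_sub, Pi.sub_apply]; ring
      rw [e4]
      have e5 := norm_sub_le ((φ j p - g p) - (ψ j p - h p) + g p) (h p)
      have e6 := norm_add_le ((φ j p - g p) - (ψ j p - h p)) (g p)
      have e7 := norm_sub_le (φ j p - g p) (ψ j p - h p)
      linarith [hC p, hD p]
    rw [Real.norm_of_nonneg (by positivity)]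
    exact pow_le_pow_left₀ (norm_nonneg _) e3 2
  · exact integrable_const _
  · refine Eventually.of_forall fun p => ?_
    exact (((hφ.tendsto_at p).sub (hψ.tendsto_at p)).norm).pow 2

/-! ### Spectral integrals of unbounded functions with values in `ℂ ∪ {∞}` -/

/-- The Borel `σ`-algebra of the one-point compactification `ℂ ∪ {∞}`. -/
instance : MeasurableSpace (OnePoint ℂ) := borel _
instance : BorelSpace (OnePoint ℂ) := ⟨rfl⟩

/-- `|f|²` with values in `[0, ∞]`, where `|∞| = ∞`. -/
def extNormSq : OnePoint ℂ → ℝ≥0∞ := fun w => w.elim ⊤ fun z => ENNReal.ofReal (‖z‖ ^ 2)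

/-- The truncation `w ↦ w` for `|w| ≤ j` and `w ↦ 0` otherwise. -/
def trunc (j : ℕ) : OnePoint ℂ → ℂ := fun w => w.elim 0 fun z => if ‖z‖ ≤ j then z else 0

theorem measurable_trunc (j : ℕ) : Measurable (trunc j) := by
  have hemb : MeasurableEmbedding ((↑) : ℂ → OnePoint ℂ) :=
    OnePoint.isOpenEmbedding_coe.measurableEmbedding
  have h1 : Measurable fun z : ℂ => if ‖z‖ ≤ j then z else 0 :=
    Measurable.ite (measurableSet_le measurable_norm measurable_const) measurable_id
      measurable_const
  intro S hS
  have h2 : trunc j ⁻¹' S = ((↑) : ℂ → OnePoint ℂ) '' ((fun z : ℂ => if ‖z‖ ≤ j then z else 0) ⁻¹' S)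
      ∪ {w | w = OnePoint.infty ∧ (0 : ℂ) ∈ S} := by
    ext w
    induction w using OnePoint.rec with
    | infty => simp [trunc]
    | coe z => simp [trunc]
  rw [h2]
  refine (hemb.measurableSet_image.2 (h1 hS)).union ?_
  by_cases h0 : (0 : ℂ) ∈ S <;> simp [h0]

theorem trunc_bounded (j : ℕ) (f : Ω → OnePoint ℂ) : ∃ C, ∀ p, ‖trunc j (f p)‖ ≤ C := by
  refine ⟨j, fun p => ?_⟩
  induction f p using OnePoint.rec with
  | infty => simp [trunc]
  | coe z => simp only [trunc, OnePoint.elim_some]; split_ifs with h <;> simp [h]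

theorem trunc_sq_le (j : ℕ) (w : OnePoint ℂ) : ENNReal.ofReal (‖trunc j w‖ ^ 2) ≤ extNormSq w := by
  induction w using OnePoint.rec with
  | infty => simp [trunc, extNormSq]
  | coe z => simp only [trunc, extNormSq, OnePoint.elim_some]; split_ifs <;> simp

theorem trunc_sub_sq {i j : ℕ} (h : i ≤ j) (w : OnePoint ℂ) :
    ‖trunc j w - trunc i w‖ ^ 2 = ‖trunc j w‖ ^ 2 - ‖trunc i w‖ ^ 2 := by
  induction w using OnePoint.rec with
  | infty => simp [trunc]
  | coe z =>
    have h' : (i : ℝ) ≤ j := by exact_mod_cast h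
    simp only [trunc, OnePoint.elim_some]
    by_cases hi : ‖z‖ ≤ i
    · simp [hi, hi.trans h']
    · simp [hi]

/-- The spectral integral of the bounded function `f χ_M` with `M = {|f| ≤ j}`; these sets form a
bounding sequence for `f`. -/
def truncIntegral (hJ : E.IsAssociated J) {f : Ω → OnePoint ℂ} (hf : Measurable f) (j : ℕ) :
    BoundedOp n H :=
  E.boundedIntegral hJ (fun p => trunc j (f p)) ((measurable_trunc j).comp hf) (trunc_bounded j f)

/-- `D(𝕀(f)) = {x : ∫ |f|² d(Re ⟨E x, x⟩) < ∞}`. -/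
def integralDomain (E : SpectralMeasure n H Ω) (f : Ω → OnePoint ℂ) :
    Submodule (Cl n)ᵐᵒᵖ (CliffordModule n H) where
  carrier := {x | ∫⁻ p, extNormSq (f p) ∂(E.reMeasure x) < ⊤}
  zero_mem' := by
    have : E.reMeasure (0 : CliffordModule n H) = 0 := by
      rw [← Measure.measure_univ_eq_zero, E.reMeasure_apply _ MeasurableSet.univ]; simp
    simp [this]
  add_mem' {x y} hx hy := by
    refine (lintegral_mono' (E.reMeasure_add_le x y) le_rfl).trans_lt ?_
    rw [lintegral_smul_measure, lintegral_add_measure]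
    exact ENNReal.mul_lt_top (by simp) (ENNReal.add_lt_top.2 ⟨hx, hy⟩)
  smul_mem' a x hx := by
    refine (lintegral_mono' (E.reMeasure_smul_le a x) le_rfl).trans_lt ?_
    rw [lintegral_smul_measure]
    exact ENNReal.mul_lt_top ENNReal.ofReal_lt_top hx

theorem exists_tendsto_truncIntegral (hJ : E.IsAssociated J) {f : Ω → OnePoint ℂ}
    (hf : Measurable f) {x : CliffordModule n H} (hx : x ∈ E.integralDomain f) :
    ∃ y, Tendsto (fun j => truncIntegral hJ hf j x) atTop (𝓝 y) := by
  have hm : ∀ j, Measurable fun p => trunc j (f p) := fun j => (measurable_trunc j).comp hf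
  let a : ℕ → ℝ := fun j => ∫ p, ‖trunc j (f p)‖ ^ 2 ∂(E.reMeasure x)
  have hint : ∀ j, Integrable (fun p => ‖trunc j (f p)‖ ^ 2) (E.reMeasure x) := fun j => by
    obtain ⟨C, hC⟩ := trunc_bounded j f
    refine Integrable.of_bound ((hm j).norm.pow_const 2).aestronglyMeasurable (C ^ 2)
      (Eventually.of_forall fun p => ?_)
    rw [Real.norm_of_nonneg (by positivity)]
    exact pow_le_pow_left₀ (norm_nonneg _) (hC p) 2
  have hdiff : ∀ i j, i ≤ j →
      ‖truncIntegral hJ hf j x - truncIntegral hJ hf i x‖ ^ 2 = a j - a i := fun i j hij => by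
    rw [truncIntegral, truncIntegral, norm_boundedIntegral_sub_sq hJ, ← integral_sub (hint j) (hint i)]
    exact integral_congr_ae (Eventually.of_forall fun p => trunc_sub_sq hij (f p))
  have hmono : Monotone a := fun i j hij => by
    have := hdiff i j hij
    nlinarith [sq_nonneg ‖truncIntegral hJ hf j x - truncIntegral hJ hf i x‖]
  have hbdd : BddAbove (Set.range a) := by
    refine ⟨(∫⁻ p, extNormSq (f p) ∂(E.reMeasure x)).toReal, ?_⟩
    rintro _ ⟨j, rfl⟩
    simp only [a]
    rw [integral_eq_lintegral_of_nonneg_ae (Eventually.of_forall fun p => by positivity)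
      ((hm j).norm.pow_const 2).aestronglyMeasurable]
    exact ENNReal.toReal_mono (ne_of_lt hx) (lintegral_mono fun p => trunc_sq_le j (f p))
  have hcau : CauchySeq a := (tendsto_atTop_ciSup hmono hbdd).cauchySeq
  refine cauchySeq_tendsto_of_complete (Metric.cauchySeq_iff'.2 fun ε hε => ?_)
  obtain ⟨N, hN⟩ := Metric.cauchySeq_iff'.1 hcau (ε ^ 2) (by positivity)
  refine ⟨N, fun j hj => ?_⟩
  rw [dist_eq_norm]
  refine lt_of_pow_lt_pow_left₀ 2 hε.le ?_
  rw [hdiff N j hj]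
  exact (le_abs_self _).trans_lt (hN j hj)

/-- `𝕀(f) x = lim_j 𝕀(f χ_{|f| ≤ j}) x` for `x ∈ D(𝕀(f))`. -/
def spectralIntegral (hJ : E.IsAssociated J) {f : Ω → OnePoint ℂ} (hf : Measurable f) :
    PartialOp n H where
  domain := E.integralDomain f
  toFun :=
    { toFun := fun x => Classical.choose (exists_tendsto_truncIntegral hJ hf x.2)
      map_add' := fun x y => by
        have hx := Classical.choose_spec (exists_tendsto_truncIntegral hJ hf x.2)
        have hy := Classical.choose_spec (exists_tendsto_truncIntegral hJ hf y.2)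
        refine tendsto_nhds_unique
          (Classical.choose_spec (exists_tendsto_truncIntegral hJ hf (x + y).2)) ?_
        simpa using hx.add hy
      map_smul' := fun a x => by
        have hx := Classical.choose_spec (exists_tendsto_truncIntegral hJ hf x.2)
        refine tendsto_nhds_unique
          (Classical.choose_spec (exists_tendsto_truncIntegral hJ hf (a • x).2)) ?_
        simpa using hx.const_smul a }

theorem tendsto_truncIntegral (hJ : E.IsAssociated J) {f : Ω → OnePoint ℂ} (hf : Measurable f)
    (x : (spectralIntegral hJ hf).domain) :
    Tendsto (fun j => truncIntegral hJ hf j x) atTop (𝓝 (spectralIntegral hJ hf x)) :=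
  Classical.choose_spec (exists_tendsto_truncIntegral hJ hf x.2)

end SpectralMeasure

end SpectralMeasure

/-- Intrinsic functions on a subset `Ω` of the closed upper half plane, with the value `∞` allowed:
where it is finite, `f(u + v i) = f₀(u, v) + f₁(u, v) i` with real `f₀`, `f₁` such that
`f₀(u, -v) = f₀(u, v)` and `f₁(u, -v) = -f₁(u, v)`. -/
def IsIntrinsic {Ω : Set ℂ} (f : Ω → OnePoint ℂ) : Prop :=
  ∃ f₀ f₁ : ℝ → ℝ → ℝ, (∀ u v, f₀ u (-v) = f₀ u v) ∧ (∀ u v, f₁ u (-v) = -f₁ u v) ∧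
    ∀ p : Ω, f p ≠ OnePoint.infty →
      f p = ((⟨f₀ (p : ℂ).re (p : ℂ).im, f₁ (p : ℂ).re (p : ℂ).im⟩ : ℂ) : OnePoint ℂ)

end CliffordSpectral

end

noncomputable section

set_option linter.unusedSectionVars false

namespace CliffordSpectral

open CliffordModule

variable {n : ℕ} {H : Type*} [NormedAddCommGroup H] [InnerProductSpace ℝ H]
  {Ω : Type*} [MeasurableSpace Ω]

/-! Write `T` for `𝕀(f)`, `q = f² - 2 Re(s) f + |s|²`, `P_k = E {|f| ≤ k}` and `μ_x` for the measure
`M ↦ ‖E(M) x‖²`. The bounded functional calculus is multiplicative, because `J` commutes with `E`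
and `J² = -1`, so that `u + v i ↦ u + v J` respects products; it is isometric in the sense `‖𝕀(g)
x‖² = ∫ |g|² dμ_x`. Since the coefficients of `q` are real, `Q_s(T)` is multiplication by `q` in
this calculus, and the claim is that `s` lies in the resolvent set exactly when `q` is essentially
bounded away from zero.

A product rule for unbounded integrals is avoided by cutting with `P_k`, which tends strongly to the
identity because `f` is finite `E`-almost everywhere (`tendsto_sublevel`). The range of `P_k` lies
in `D(T²)` and is invariant under `T`. Both `P_k Q_s(T)` on `D(T²)` and `Q_s(T)` on the range of
`P_k` are given by the bounded operator `𝕀(q χ_{|f| ≤ k})` (`sublevel_apply_Q`, `exists_Q_eq`).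

If `E {|q| < ε} = 0`, the isometry gives `‖P_k Q_s(T) x‖ ≥ ε ‖P_k x‖`, and `k → ∞` yields
injectivity and a bounded inverse (`le_norm_Q`). The range is dense since it contains every `P_k y`,
a preimage being obtained by integrating `1/q` over `{|f| ≤ k}` (`sublevel_apply_mem_range_Q`). If
`E {|q| < ε} ≠ 0` for all `ε`, there are nonzero `z` with `‖Q_s(T) z‖ ≤ ε ‖z‖`, so no bound on the
inverse exists (`exists_norm_Q_le`). -/

theorem TendstoOpNorm.tendsto_apply {A : ℕ → BoundedOp n H} {B : BoundedOp n H}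
    (h : TendstoOpNorm A B) {y : ℕ → CliffordModule n H} {z : CliffordModule n H}
    (hy : Tendsto y atTop (𝓝 z)) : Tendsto (fun j => A j (y j)) atTop (𝓝 (B z)) := by
  have h0 : Tendsto (fun j => A j (y j) - B (y j)) atTop (𝓝 0) := by
    rw [Metric.tendsto_nhds]
    intro ε hε
    -- Eventually `‖y j‖ < ‖z‖ + 1`, so operator norm closeness is uniform along the moving vectors;
    -- the denominator `‖z‖ + 2` makes the final estimate strict.
    obtain ⟨N, hN⟩ := h (ε / (‖z‖ + 2)) (by positivity)
    filter_upwards [eventually_ge_atTop N,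
      hy.norm.eventually_lt_const (lt_add_one ‖z‖)] with j hj hyj
    rw [dist_zero_right]
    refine (hN j hj _).trans_lt ?_
    rw [div_mul_eq_mul_div, div_lt_iff₀ (by positivity)]
    nlinarith [norm_nonneg z]
  simpa using h0.add ((B.continuous.tendsto z).comp hy)

theorem IsImaginary.apply_apply {J : BoundedOp n H} (h : IsImaginary J) (x : CliffordModule n H) :
    J (J x) = -x := by
  have := congrArg (fun A : BoundedOp n H => A x) h.2.1
  simp only [mul_apply_eq_comp, neg_apply, map_neg, one_apply_eq_self] at this
  exact neg_eq_iff_eq_neg.1 this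

namespace SpectralMeasure

variable {E : SpectralMeasure n H Ω} {J : BoundedOp n H}

theorem map_add_map_compl {M : Set Ω} (hM : MeasurableSet M) (x : CliffordModule n H) :
    E M x + E Mᶜ x = x := by
  rw [← add_apply, ← E.union hM hM.compl disjoint_compl_right, Set.union_compl_self, E.univ]
  rfl

/-! ### Algebraic properties of the bounded functional calculus -/

theorem simpleIntegral_add (φ ψ : SimpleFunc Ω ℂ) (x : CliffordModule n H) :
    E.simpleIntegral J (φ + ψ) x = E.simpleIntegral J φ x + E.simpleIntegral J ψ x := by
  rw [simpleIntegral_apply, simpleIntegral_apply, simpleIntegral_apply]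
  exact SimpleFunc.setToSimpleFunc_add _ (weight_finMeasAdditive x) (by simp) (by simp)

theorem simpleIntegral_map (P : SimpleFunc Ω (ℂ × ℂ)) (g : ℂ × ℂ → ℂ) (hg : g 0 = 0)
    (x : CliffordModule n H) :
    E.simpleIntegral J (P.map g) x = ∑ b ∈ P.range, weight E J x (P ⁻¹' {b}) (g b) := by
  rw [simpleIntegral_apply]
  exact SimpleFunc.map_setToSimpleFunc _ (weight_finMeasAdditive x)
    -- Additivity of `weight` is stated relative to the measure `0`, so integrability conditions are
    -- void.
    (integrable_zero_measure) hg

/-- This is where complex multiplication enters: `E M` is idempotent and commutes with `J`, and `J²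
= -1` supplies the sign in the real part of `c * d`. -/
theorem weight_weight (hJ : E.IsAssociated J) {M : Set Ω} (hM : MeasurableSet M) (c d : ℂ)
    (x : CliffordModule n H) :
    weight E J (weight E J x M d) M c = weight E J x M (c * d) := by
  have hJE : ∀ y, J (E M y) = E M (J y) := fun y => by
    rw [← mul_apply_eq_comp, hJ.comm M hM, mul_apply_eq_comp]
  simp only [weight, add_apply, ContinuousLinearMap.smulRight_apply, Complex.reCLM_apply,
    Complex.imCLM_apply, map_add, map_real_smul, hJE, E.apply_apply hM,
    hJ.imaginary.apply_apply, map_neg, Complex.mul_re, Complex.mul_im]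
  module

theorem weight_weight_of_disjoint (hJ : E.IsAssociated J) {M N : Set Ω} (hM : MeasurableSet M)
    (hN : MeasurableSet N) (h : Disjoint M N) (c d : ℂ) (x : CliffordModule n H) :
    weight E J (weight E J x N d) M c = 0 := by
  have hJE : ∀ y, J (E N y) = E N (J y) := fun y => by
    rw [← mul_apply_eq_comp, hJ.comm N hN, mul_apply_eq_comp]
  simp [weight, map_real_smul, hJE, E.mul_eq_zero hM hN h]

theorem weight_sum {ι : Type*} (s : Finset ι) (y : ι → CliffordModule n H) (M : Set Ω) (c : ℂ) :
    weight E J (∑ i ∈ s, y i) M c = ∑ i ∈ s, weight E J (y i) M c := by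
  simp [weight, Finset.smul_sum, Finset.sum_add_distrib]

/-- All three integrals are expanded over one partition, the fibres of the pair `(φ, ψ)`. Cross
terms vanish because `E` is orthogonal on disjoint sets, and diagonal terms multiply by
`weight_weight`. -/
theorem simpleIntegral_mul (hJ : E.IsAssociated J) (φ ψ : SimpleFunc Ω ℂ)
    (x : CliffordModule n H) :
    E.simpleIntegral J (φ * ψ) x = E.simpleIntegral J φ (E.simpleIntegral J ψ x) := by
  have hm : ∀ a, MeasurableSet (φ.pair ψ ⁻¹' {a}) := fun a => (φ.pair ψ).measurableSet_preimage _
  have h1 := simpleIntegral_map (E := E) (J := J) (φ.pair ψ) (fun a => a.1 * a.2) (by simp) x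
  have h2 := simpleIntegral_map (E := E) (J := J) (φ.pair ψ) Prod.snd rfl x
  have h3 := simpleIntegral_map (E := E) (J := J) (φ.pair ψ) Prod.fst rfl
    (E.simpleIntegral J ψ x)
  rw [SimpleFunc.map_snd_pair] at h2
  rw [SimpleFunc.map_fst_pair, h2] at h3
  rw [h2, h3, ← SimpleFunc.mul_eq_map₂] at *
  rw [h1]
  refine Finset.sum_congr rfl fun a ha => ?_
  rw [weight_sum, Finset.sum_eq_single a, weight_weight hJ (hm a)]
  · intro b _ hb
    exact weight_weight_of_disjoint hJ (hm a) (hm b)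
      (Disjoint.preimage _ (Set.disjoint_singleton.2 hb.symm)) _ _ _
  · exact fun h => (h ha).elim

/-! ### Passage from simple to bounded measurable functions. -/

section

variable [CompleteSpace H]

theorem boundedIntegral_simple (hJ : E.IsAssociated J) (φ : SimpleFunc Ω ℂ)
    (hb : ∃ C, ∀ p, ‖φ p‖ ≤ C) (x : CliffordModule n H) :
    E.boundedIntegral hJ φ φ.measurable hb x = E.simpleIntegral J φ x := by
  have h := boundedIntegral_spec hJ φ.measurable hb (fun _ => φ)
    (Metric.tendstoUniformly_iff.2 fun ε hε => by simp [hε])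
  exact tendsto_nhds_unique (tendsto_of_tendstoOpNorm h x) tendsto_const_nhds |>.symm ▸ rfl

theorem boundedIntegral_add (hJ : E.IsAssociated J) {g h : Ω → ℂ} (hg : Measurable g)
    (hgb : ∃ C, ∀ p, ‖g p‖ ≤ C) (hh : Measurable h) (hhb : ∃ C, ∀ p, ‖h p‖ ≤ C)
    (hs : Measurable fun p => g p + h p) (hsb : ∃ C, ∀ p, ‖g p + h p‖ ≤ C)
    (x : CliffordModule n H) :
    E.boundedIntegral hJ (fun p => g p + h p) hs hsb x =
      E.boundedIntegral hJ g hg hgb x + E.boundedIntegral hJ h hh hhb x := by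
  obtain ⟨φ, hφ⟩ := exists_simple_approx hg hgb
  obtain ⟨ψ, hψ⟩ := exists_simple_approx hh hhb
  have h1 := tendsto_of_tendstoOpNorm (boundedIntegral_spec hJ hg hgb φ hφ) x
  have h2 := tendsto_of_tendstoOpNorm (boundedIntegral_spec hJ hh hhb ψ hψ) x
  have h3 := tendsto_of_tendstoOpNorm
    (boundedIntegral_spec hJ hs hsb (fun j => φ j + ψ j) (hφ.add hψ)) x
  simp only [simpleIntegral_add] at h3
  exact tendsto_nhds_unique h3 (h1.add h2)

/-- Boundedness of the limits controls both terms of `g h - F G = g (h - G) + (g - F) G`. -/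
theorem tendstoUniformly_mul_of_bounded {α : Type*} {F G : ℕ → α → ℂ} {g h : α → ℂ}
    (hF : TendstoUniformly F g atTop) (hG : TendstoUniformly G h atTop)
    (hgb : ∃ C, ∀ p, ‖g p‖ ≤ C) (hhb : ∃ C, ∀ p, ‖h p‖ ≤ C) :
    TendstoUniformly (fun j p => F j p * G j p) (fun p => g p * h p) atTop := by
  obtain ⟨C, hC⟩ := hgb
  obtain ⟨D, hD⟩ := hhb
  rw [Metric.tendstoUniformly_iff] at *
  intro ε hε
  have hK : 0 < |C| + |D| + 2 := by positivity
  -- The bound `1` gives `‖G j p‖ ≤ |D| + 1`. The total error is then at most `δ (|C| + |D| + 1)`,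
  -- and the `2` in the denominator leaves room for strict inequality.
  have hδ : 0 < min 1 (ε / (|C| + |D| + 2)) := lt_min one_pos (by positivity)
  filter_upwards [hF _ hδ, hG _ hδ] with j h1 h2 p
  have e1 := h1 p
  have e2 := h2 p
  rw [dist_eq_norm] at *
  set δ := min 1 (ε / (|C| + |D| + 2))
  have hδ1 : δ ≤ 1 := min_le_left _ _
  have hδ2 : δ * (|C| + |D| + 2) ≤ ε := by
    rw [← le_div_iff₀ hK]; exact min_le_right _ _
  have e3 : ‖G j p‖ ≤ |D| + 1 := by
    have := norm_sub_norm_le (G j p) (h p)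
    rw [norm_sub_rev] at this
    linarith [hD p, le_abs_self D]
  have e4 : g p * h p - F j p * G j p = g p * (h p - G j p) + (g p - F j p) * G j p := by ring
  rw [e4]
  refine (norm_add_le _ _).trans_lt ?_
  rw [norm_mul, norm_mul]
  have e5 : ‖g p‖ * ‖h p - G j p‖ ≤ |C| * δ :=
    mul_le_mul ((hC p).trans (le_abs_self C)) e2.le (norm_nonneg _) (abs_nonneg C)
  have e6 : ‖g p - F j p‖ * ‖G j p‖ ≤ δ * (|D| + 1) :=
    mul_le_mul e1.le e3 (norm_nonneg _) hδ.le
  nlinarith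

theorem boundedIntegral_mul (hJ : E.IsAssociated J) {g h : Ω → ℂ} (hg : Measurable g)
    (hgb : ∃ C, ∀ p, ‖g p‖ ≤ C) (hh : Measurable h) (hhb : ∃ C, ∀ p, ‖h p‖ ≤ C)
    (hs : Measurable fun p => g p * h p) (hsb : ∃ C, ∀ p, ‖g p * h p‖ ≤ C)
    (x : CliffordModule n H) :
    E.boundedIntegral hJ (fun p => g p * h p) hs hsb x =
      E.boundedIntegral hJ g hg hgb (E.boundedIntegral hJ h hh hhb x) := by
  obtain ⟨φ, hφ⟩ := exists_simple_approx hg hgb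
  obtain ⟨ψ, hψ⟩ := exists_simple_approx hh hhb
  have h2 := tendsto_of_tendstoOpNorm (boundedIntegral_spec hJ hh hhb ψ hψ) x
  -- Operator and vector vary together here, so strong convergence alone would not be enough.
  have h1 := (boundedIntegral_spec hJ hg hgb φ hφ).tendsto_apply h2
  have h3 := tendsto_of_tendstoOpNorm (boundedIntegral_spec hJ hs hsb (fun j => φ j * ψ j)
    (tendstoUniformly_mul_of_bounded hφ hψ hgb hhb)) x
  simp only [simpleIntegral_mul hJ] at h3
  exact tendsto_nhds_unique h3 h1

open Classical in
theorem boundedIntegral_indicator_const (hJ : E.IsAssociated J) {M : Set Ω} (hM : MeasurableSet M)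
    (c : ℝ) (hm : Measurable (M.indicator fun _ => (c : ℂ)))
    (hb : ∃ C, ∀ p, ‖M.indicator (fun _ => (c : ℂ)) p‖ ≤ C) (x : CliffordModule n H) :
    E.boundedIntegral hJ (M.indicator fun _ => (c : ℂ)) hm hb x = c • E M x := by
  let φ : SimpleFunc Ω ℂ := SimpleFunc.piecewise M hM (SimpleFunc.const Ω (c : ℂ))
    (SimpleFunc.const Ω 0)
  have hφ : (φ : Ω → ℂ) = M.indicator fun _ => (c : ℂ) := by
    ext p; simp [φ, Set.indicator_apply, Set.piecewise]
  have h1 : E.boundedIntegral hJ (M.indicator fun _ => (c : ℂ)) hm hb x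
      = E.simpleIntegral J φ x := by
    rw [← boundedIntegral_simple hJ φ (hφ ▸ hb)]
    congr!
  rw [h1, simpleIntegral_apply, SimpleFunc.setToSimpleFunc_indicator]
  · simp [weight]
  · ext; simp [weight, E.empty]

theorem norm_boundedIntegral_sq (hJ : E.IsAssociated J) {g : Ω → ℂ} (hg : Measurable g)
    (hgb : ∃ C, ∀ p, ‖g p‖ ≤ C) (x : CliffordModule n H) :
    ‖E.boundedIntegral hJ g hg hgb x‖ ^ 2 = ∫ p, ‖g p‖ ^ 2 ∂(E.reMeasure x) := by
  -- The isometry is the distance formula with second function zero, written as an indicator of `∅`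
  -- so that its integral is already known.
  have h0 := boundedIntegral_indicator_const hJ (M := ∅) MeasurableSet.empty 0
    (by simp) ⟨0, by simp⟩ x
  have h := norm_boundedIntegral_sub_sq hJ hg hgb
    (h := (∅ : Set Ω).indicator fun _ => ((0 : ℝ) : ℂ)) (by simp) ⟨0, by simp⟩ x
  rw [h0] at h
  simpa using h

end

/-! ### The spectral subspaces of `{|f| ≤ k}` -/

/-- The points where `f` is finite with value in `A`. -/
def finitePreimage (f : Ω → OnePoint ℂ) (A : Set ℂ) : Set Ω :=
  {p | ∃ w : ℂ, f p = (w : OnePoint ℂ) ∧ w ∈ A}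

theorem measurableSet_finitePreimage {f : Ω → OnePoint ℂ} (hf : Measurable f) {A : Set ℂ}
    (hA : MeasurableSet A) : MeasurableSet (finitePreimage f A) := by
  have h : finitePreimage f A = f ⁻¹' (((↑) : ℂ → OnePoint ℂ) '' A) := by
    ext p
    simp only [finitePreimage, Set.mem_ofPred_eq, Set.mem_preimage, Set.mem_image]
    exact exists_congr fun w => by rw [and_comm, eq_comm]
  rw [h]
  exact hf (OnePoint.isOpenEmbedding_coe.measurableEmbedding.measurableSet_image.2 hA)

/-- The set `{|f| ≤ k}`. -/
def sublevel (f : Ω → OnePoint ℂ) (k : ℕ) : Set Ω := finitePreimage f {w | ‖w‖ ≤ k}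

theorem measurableSet_sublevel {f : Ω → OnePoint ℂ} (hf : Measurable f) (k : ℕ) :
    MeasurableSet (sublevel f k) :=
  measurableSet_finitePreimage hf (measurableSet_le measurable_norm measurable_const)

theorem trunc_of_mem {f : Ω → OnePoint ℂ} {k : ℕ} {p : Ω} (hp : p ∈ sublevel f k) :
    f p = (trunc k (f p) : OnePoint ℂ) := by
  obtain ⟨w, hw, hwk⟩ := hp
  rw [hw]
  simp [trunc, show ‖w‖ ≤ k from hwk]

theorem trunc_of_notMem {f : Ω → OnePoint ℂ} {k : ℕ} {p : Ω} (hp : p ∉ sublevel f k) :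
    trunc k (f p) = 0 := by
  by_contra h
  apply hp
  cases hw : f p using OnePoint.rec with
  | infty => simp [hw, trunc] at h
  | coe w =>
    refine ⟨w, hw, ?_⟩
    by_contra hk
    exact h (by simp [hw, trunc, show ¬ ‖w‖ ≤ k from hk])

/-- `E {|f| ≤ k}` converges strongly to the identity if `f` is finite almost everywhere. -/
theorem tendsto_sublevel {f : Ω → OnePoint ℂ} (hf : Measurable f)
    (hfin : E {p | f p = OnePoint.infty} = 0) (x : CliffordModule n H) :
    Tendsto (fun k => E (sublevel f k) x) atTop (𝓝 x) := by
  have hm := measurableSet_sublevel hf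
  have hanti : Antitone fun k => (sublevel f k)ᶜ := fun i j hij =>
    Set.compl_subset_compl.2 fun p ⟨w, hw, hwi⟩ =>
      ⟨w, hw, show ‖w‖ ≤ j from le_trans hwi (Nat.cast_le.2 hij)⟩
  have hInter : ⋂ k, (sublevel f k)ᶜ = {p | f p = OnePoint.infty} := by
    ext p
    simp only [Set.mem_iInter, Set.mem_compl_iff, Set.mem_ofPred_eq]
    constructor
    · intro h
      cases hw : f p using OnePoint.rec with
      | infty => rfl
      | coe w =>
        obtain ⟨k, hk⟩ := exists_nat_ge ‖w‖
        exact (h k ⟨w, hw, hk⟩).elim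
    · rintro h k ⟨w, hw, -⟩
      exact OnePoint.coe_ne_infty w (hw.symm.trans h)
  have hmi : MeasurableSet {p | f p = OnePoint.infty} :=
    hInter ▸ MeasurableSet.iInter fun k => (hm k).compl
  -- Continuity from above of the finite measure `μ_x`: the sets `{|f| ≤ k}ᶜ` decrease to `{f = ∞}`,
  -- which is null.
  have h1 := tendsto_measure_iInter_atTop (μ := E.reMeasure x)
    (fun k => (hm k).compl.nullMeasurableSet) hanti ⟨0, measure_ne_top _ _⟩
  rw [hInter, E.reMeasure_apply x hmi, hfin] at h1
  have h2 := (ENNReal.tendsto_toReal (by simp)).comp h1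
  have h3 : Tendsto (fun k => ‖E (sublevel f k)ᶜ x‖ ^ 2) atTop (𝓝 0) := by
    simpa [Function.comp_def, E.reMeasure_apply x (hm _).compl] using h2
  have h4 : Tendsto (fun k => ‖E (sublevel f k)ᶜ x‖) atTop (𝓝 0) := by
    simpa [Real.sqrt_sq] using h3.sqrt
  have h5 := (tendsto_const_nhds (x := x)).sub (tendsto_zero_iff_norm_tendsto_zero.2 h4)
  rw [sub_zero] at h5
  refine h5.congr fun k => ?_
  rw [sub_eq_iff_eq_add, map_add_map_compl (hm k)]

variable [CompleteSpace H]

/-- Presents `E M` as an integral, so that the product rule also describes composition with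
projections. -/
theorem boundedIntegral_one_indicator (hJ : E.IsAssociated J) {M : Set Ω} (hM : MeasurableSet M)
    (x : CliffordModule n H) :
    ∃ hm hb, E.boundedIntegral hJ (M.indicator fun _ => ((1 : ℝ) : ℂ)) hm hb x = E M x := by
  refine ⟨measurable_const.indicator hM, ⟨1, fun p => ?_⟩, ?_⟩
  · exact (norm_indicator_le_norm_self _ _).trans (by simp)
  · rw [boundedIntegral_indicator_const hJ hM, one_smul]

/-- Two bounded functions which agree after multiplication by `χ_M` have the same integrals on the
range of `E M`. -/
theorem boundedIntegral_apply_range (hJ : E.IsAssociated J) {M : Set Ω} (hM : MeasurableSet M)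
    {g h : Ω → ℂ} (hg : Measurable g) (hgb : ∃ C, ∀ p, ‖g p‖ ≤ C)
    (hh : Measurable h) (hhb : ∃ C, ∀ p, ‖h p‖ ≤ C) (hgh : M.indicator g = h)
    (x : CliffordModule n H) :
    E.boundedIntegral hJ g hg hgb (E M x) = E.boundedIntegral hJ h hh hhb x := by
  obtain ⟨hm, hb, h1⟩ := boundedIntegral_one_indicator hJ hM x
  have e : h = fun p => g p * M.indicator (fun _ => ((1 : ℝ) : ℂ)) p := by
    rw [← hgh]; ext p; by_cases hp : p ∈ M <;> simp [hp]
  subst e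
  rw [boundedIntegral_mul hJ hg hgb hm hb hh hhb, h1]

/-- Together with `boundedIntegral_apply_range` this shows that `E M` commutes with every bounded
integral. -/
theorem apply_boundedIntegral (hJ : E.IsAssociated J) {M : Set Ω} (hM : MeasurableSet M)
    {g h : Ω → ℂ} (hg : Measurable g) (hgb : ∃ C, ∀ p, ‖g p‖ ≤ C)
    (hh : Measurable h) (hhb : ∃ C, ∀ p, ‖h p‖ ≤ C) (hgh : M.indicator g = h)
    (x : CliffordModule n H) :
    E M (E.boundedIntegral hJ g hg hgb x) = E.boundedIntegral hJ h hh hhb x := by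
  obtain ⟨hm, hb, h1⟩ := boundedIntegral_one_indicator hJ hM (E.boundedIntegral hJ g hg hgb x)
  have e : h = fun p => M.indicator (fun _ => ((1 : ℝ) : ℂ)) p * g p := by
    rw [← hgh]; ext p; by_cases hp : p ∈ M <;> simp [hp]
  subst e
  rw [boundedIntegral_mul hJ hm hb hg hgb hh hhb, h1]

theorem indicator_sublevel_trunc (f : Ω → OnePoint ℂ) {k j : ℕ} (h : k ≤ j) :
    (sublevel f k).indicator (fun p => trunc j (f p)) = fun p => trunc k (f p) := by
  ext p
  by_cases hp : p ∈ sublevel f k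
  · obtain ⟨w, hw, hwk⟩ := hp
    have hwk' : ‖w‖ ≤ k := hwk
    have hp : p ∈ sublevel f k := ⟨w, hw, hwk⟩
    rw [Set.indicator_of_mem hp, hw]
    simp [trunc, hwk', hwk'.trans (Nat.cast_le.2 h)]
  · rw [Set.indicator_of_notMem hp, trunc_of_notMem hp]

/-! ### Truncated integrals and the action of `𝕀(f)` on the ranges of `E {|f| ≤ k}`. -/

section

variable {f : Ω → OnePoint ℂ}

theorem truncIntegral_apply_sublevel (hJ : E.IsAssociated J) (hf : Measurable f) {k j : ℕ}
    (h : k ≤ j) (x : CliffordModule n H) :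
    truncIntegral hJ hf j (E (sublevel f k) x) = truncIntegral hJ hf k x :=
  boundedIntegral_apply_range hJ (measurableSet_sublevel hf k) _ _ _ _
    (indicator_sublevel_trunc f h) x

theorem sublevel_apply_truncIntegral (hJ : E.IsAssociated J) (hf : Measurable f) {k j : ℕ}
    (h : k ≤ j) (x : CliffordModule n H) :
    E (sublevel f k) (truncIntegral hJ hf j x) = truncIntegral hJ hf k x :=
  apply_boundedIntegral hJ (measurableSet_sublevel hf k) _ _ _ _
    (indicator_sublevel_trunc f h) x

/-- The measure `μ_z` is concentrated on `{|f| ≤ k}`, where `|f|²` is at most `k²`. -/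
theorem mem_integralDomain (hf : Measurable f) {k : ℕ} {z : CliffordModule n H}
    (hz : E (sublevel f k) z = z) : z ∈ E.integralDomain f := by
  change ∫⁻ p, extNormSq (f p) ∂(E.reMeasure z) < ⊤
  have hm := measurableSet_sublevel hf k
  have h0 : E.reMeasure z (sublevel f k)ᶜ = 0 := by
    rw [E.reMeasure_apply z hm.compl, ← hz, E.mul_eq_zero hm.compl hm disjoint_compl_left]
    simp
  have hae : ∀ᵐ p ∂(E.reMeasure z), p ∈ sublevel f k := h0
  refine (lintegral_mono_ae (g := fun _ => ENNReal.ofReal ((k : ℝ) ^ 2)) ?_).trans_lt ?_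
  · filter_upwards [hae] with p ⟨w, hw, hwk⟩
    rw [hw]
    exact ENNReal.ofReal_le_ofReal (pow_le_pow_left₀ (norm_nonneg _) hwk 2)
  · rw [lintegral_const]
    exact ENNReal.mul_lt_top ENNReal.ofReal_lt_top (measure_lt_top _ _)

/-- On such vectors the sequence defining `𝕀(f) x` is constant from index `k` on. -/
theorem spectralIntegral_apply_of_mem_range (hJ : E.IsAssociated J) (hf : Measurable f) {k : ℕ}
    (x : (spectralIntegral hJ hf).domain)
    (hx : E (sublevel f k) (x : CliffordModule n H) = x) :
    spectralIntegral hJ hf x = truncIntegral hJ hf k x := by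
  refine tendsto_nhds_unique (tendsto_truncIntegral hJ hf x) (tendsto_const_nhds.congr' ?_)
  filter_upwards [eventually_ge_atTop k] with j hj
  rw [← truncIntegral_apply_sublevel hJ hf hj, hx]

/-- Here `x` is any vector of the domain: the projection passes through the limit, and the projected
sequence is constant from index `k` on. -/
theorem sublevel_apply_spectralIntegral (hJ : E.IsAssociated J) (hf : Measurable f) (k : ℕ)
    (x : (spectralIntegral hJ hf).domain) :
    E (sublevel f k) (spectralIntegral hJ hf x) = truncIntegral hJ hf k x := by
  refine tendsto_nhds_unique (((E (sublevel f k)).continuous.tendsto _).comp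
    (tendsto_truncIntegral hJ hf x)) (tendsto_const_nhds.congr' ?_)
  filter_upwards [eventually_ge_atTop k] with j hj
  exact (sublevel_apply_truncIntegral hJ hf hj _).symm

/-! ### The operator `Q_s(𝕀(f))` on spectral subspaces -/

/-- The function `χ_{|f| ≤ k} (f² - 2 Re(s) f + |s|²)`. -/
def truncQ (s : Cl n) (f : Ω → OnePoint ℂ) (k : ℕ) (p : Ω) : ℂ :=
  (sublevel f k).indicator (fun p => trunc k (f p) ^ 2 - 2 * (s.re : ℂ) * trunc k (f p) +
    (s.abs : ℂ) ^ 2) p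

/-- Splits the function into pieces with known integrals. The term `|s|²` must be cut to `{|f| ≤
k}`, whereas the factor `-2 Re(s)` may live on the whole space because `trunc` already vanishes off
that set. -/
theorem truncQ_eq (s : Cl n) (f : Ω → OnePoint ℂ) (k : ℕ) :
    truncQ s f k = fun p => trunc k (f p) * trunc k (f p) +
      ((Set.univ.indicator (fun _ => ((-(2 * s.re) : ℝ) : ℂ)) p) * trunc k (f p) +
        (sublevel f k).indicator (fun _ => ((s.abs ^ 2 : ℝ) : ℂ)) p) := by
  ext p
  by_cases hp : p ∈ sublevel f k
  · simp [truncQ, hp]; ring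
  · simp [truncQ, hp, trunc_of_notMem hp]

theorem measurable_truncQ (s : Cl n) (hf : Measurable f) (k : ℕ) : Measurable (truncQ s f k) := by
  have h := (measurable_trunc k).comp hf
  exact (((h.pow_const 2).sub (h.const_mul _)).add_const _).indicator (measurableSet_sublevel hf k)

theorem bounded_mul {g h : Ω → ℂ} (hg : ∃ C, ∀ p, ‖g p‖ ≤ C) (hh : ∃ C, ∀ p, ‖h p‖ ≤ C) :
    ∃ C, ∀ p, ‖g p * h p‖ ≤ C := by
  obtain ⟨C, hC⟩ := hg
  obtain ⟨D, hD⟩ := hh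
  exact ⟨C * D, fun p => (norm_mul _ _).trans_le (mul_le_mul (hC p) (hD p) (norm_nonneg _)
    ((norm_nonneg _).trans (hC p)))⟩

theorem bounded_add {g h : Ω → ℂ} (hg : ∃ C, ∀ p, ‖g p‖ ≤ C) (hh : ∃ C, ∀ p, ‖h p‖ ≤ C) :
    ∃ C, ∀ p, ‖g p + h p‖ ≤ C := by
  obtain ⟨C, hC⟩ := hg
  obtain ⟨D, hD⟩ := hh
  exact ⟨C + D, fun p => (norm_add_le _ _).trans (add_le_add (hC p) (hD p))⟩

theorem bounded_indicator_const (M : Set Ω) (c : ℂ) :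
    ∃ C, ∀ p, ‖M.indicator (fun _ => c) p‖ ≤ C :=
  ⟨‖c‖, fun _ => norm_indicator_le_norm_self _ _⟩

theorem bounded_truncQ (s : Cl n) (f : Ω → OnePoint ℂ) (k : ℕ) :
    ∃ C, ∀ p, ‖truncQ s f k p‖ ≤ C := by
  rw [truncQ_eq]
  exact bounded_add (bounded_mul (trunc_bounded k f) (trunc_bounded k f))
    (bounded_add (bounded_mul (bounded_indicator_const _ _) (trunc_bounded k f))
      (bounded_indicator_const _ _))

theorem boundedIntegral_truncQ (hJ : E.IsAssociated J) (hf : Measurable f) (s : Cl n) (k : ℕ)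
    (x : CliffordModule n H) :
    E.boundedIntegral hJ (truncQ s f k) (measurable_truncQ s hf k) (bounded_truncQ s f k) x =
      truncIntegral hJ hf k (truncIntegral hJ hf k x) - (2 * s.re) • truncIntegral hJ hf k x +
        s.abs ^ 2 • E (sublevel f k) x := by
  have ht : Measurable fun p => trunc k (f p) := (measurable_trunc k).comp hf
  have htb := trunc_bounded k f
  have hu : Measurable ((Set.univ : Set Ω).indicator fun _ => ((-(2 * s.re) : ℝ) : ℂ)) :=
    measurable_const.indicator MeasurableSet.univ
  have hi : Measurable ((sublevel f k).indicator fun _ => ((s.abs ^ 2 : ℝ) : ℂ)) :=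
    measurable_const.indicator (measurableSet_sublevel hf k)
  have hub := bounded_indicator_const (Set.univ : Set Ω) ((-(2 * s.re) : ℝ) : ℂ)
  have hib := bounded_indicator_const (sublevel f k) ((s.abs ^ 2 : ℝ) : ℂ)
  have htt : Measurable fun p => trunc k (f p) * trunc k (f p) := ht.mul ht
  have hut : Measurable fun p => (Set.univ : Set Ω).indicator
      (fun _ => ((-(2 * s.re) : ℝ) : ℂ)) p * trunc k (f p) := hu.mul ht
  have huti : Measurable fun p => (Set.univ : Set Ω).indicator
      (fun _ => ((-(2 * s.re) : ℝ) : ℂ)) p * trunc k (f p) +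
        (sublevel f k).indicator (fun _ => ((s.abs ^ 2 : ℝ) : ℂ)) p := hut.add hi
  -- The measurability and boundedness proofs depend on the integrand, so it is exchanged through a
  -- variable `g`.
  have h : ∀ g, ∀ hg : g = truncQ s f k, ∀ hm hb,
      E.boundedIntegral hJ (truncQ s f k) (measurable_truncQ s hf k) (bounded_truncQ s f k) x =
      E.boundedIntegral hJ g hm hb x := by rintro g rfl _ _; rfl
  rw [h _ (truncQ_eq s f k).symm
    (htt.add huti)
    (bounded_add (bounded_mul htb htb) (bounded_add (bounded_mul hub htb) hib)),
    boundedIntegral_add hJ htt (bounded_mul htb htb) huti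
      (bounded_add (bounded_mul hub htb) hib),
    boundedIntegral_add hJ hut (bounded_mul hub htb) hi hib,
    boundedIntegral_mul hJ ht htb ht htb, boundedIntegral_mul hJ hu hub ht htb,
    boundedIntegral_indicator_const hJ MeasurableSet.univ,
    boundedIntegral_indicator_const hJ (measurableSet_sublevel hf k), E.univ]
  simp only [truncIntegral, one_apply_eq_self]
  module

theorem sublevel_apply_Q (hJ : E.IsAssociated J) (hf : Measurable f) (s : Cl n) (k : ℕ)
    (x : (spectralIntegral hJ hf).domain)
    (hx : spectralIntegral hJ hf x ∈ (spectralIntegral hJ hf).domain) :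
    E (sublevel f k) (Q (spectralIntegral hJ hf) s x hx) =
      E.boundedIntegral hJ (truncQ s f k) (measurable_truncQ s hf k) (bounded_truncQ s f k) x := by
  rw [Q, map_add, map_sub, map_real_smul, map_real_smul, sublevel_apply_spectralIntegral,
    sublevel_apply_spectralIntegral, boundedIntegral_truncQ]
  change truncIntegral hJ hf k (spectralIntegral hJ hf x) - _ + _ = _
  -- With `T_k` the truncated integral: `T_k (T x) = T_k (P_k T x) = T_k (T_k x)`.
  rw [← truncIntegral_apply_sublevel hJ hf le_rfl, sublevel_apply_spectralIntegral]

theorem exists_Q_eq (hJ : E.IsAssociated J) (hf : Measurable f) (s : Cl n) {k : ℕ}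
    {z : CliffordModule n H} (hz : E (sublevel f k) z = z) :
    ∃ (x : (spectralIntegral hJ hf).domain)
      (hx : spectralIntegral hJ hf x ∈ (spectralIntegral hJ hf).domain),
      (x : CliffordModule n H) = z ∧ Q (spectralIntegral hJ hf) s x hx =
        E.boundedIntegral hJ (truncQ s f k) (measurable_truncQ s hf k) (bounded_truncQ s f k) z := by
  let x : (spectralIntegral hJ hf).domain := ⟨z, mem_integralDomain hf hz⟩
  have h1 : spectralIntegral hJ hf x = truncIntegral hJ hf k z :=
    spectralIntegral_apply_of_mem_range hJ hf x hz
  -- Invariance of the range of `P_k` under `𝕀(f)`, which puts `z` in the domain of the square.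
  have h2 : E (sublevel f k) (spectralIntegral hJ hf x) = spectralIntegral hJ hf x := by
    rw [h1, sublevel_apply_truncIntegral hJ hf le_rfl]
  refine ⟨x, mem_integralDomain hf h2, rfl, ?_⟩
  change spectralIntegral hJ hf ⟨spectralIntegral hJ hf x, mem_integralDomain hf h2⟩ -
    (2 * s.re) • spectralIntegral hJ hf x + s.abs ^ 2 • z = _
  rw [spectralIntegral_apply_of_mem_range hJ hf ⟨_, mem_integralDomain hf h2⟩ h2,
    boundedIntegral_truncQ hJ hf, hz]
  simp only [h1]

/-! ### Resolvent criterion -/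

/-- The set `{|f² - 2 Re(s) f + |s|²| < ε}`. -/
def qSublevel (s : Cl n) (f : Ω → OnePoint ℂ) (ε : ℝ) : Set Ω :=
  finitePreimage f {w | ‖w ^ 2 - 2 * (s.re : ℂ) * w + (s.abs : ℂ) ^ 2‖ < ε}

theorem measurableSet_qSublevel (s : Cl n) (hf : Measurable f) (ε : ℝ) :
    MeasurableSet (qSublevel s f ε) :=
  measurableSet_finitePreimage hf
    (isOpen_lt (by fun_prop) continuous_const).measurableSet

theorem norm_truncQ_lt_iff {s : Cl n} {k : ℕ} {p : Ω} (hp : p ∈ sublevel f k) (ε : ℝ) :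
    ‖truncQ s f k p‖ < ε ↔ p ∈ qSublevel s f ε := by
  have h := trunc_of_mem hp
  rw [truncQ, Set.indicator_of_mem hp]
  constructor
  · exact fun h1 => ⟨_, h, h1⟩
  · rintro ⟨w, hw, h1⟩
    rw [h, OnePoint.coe_eq_coe] at hw
    rw [hw]
    exact h1

/-- The estimate is proved after applying `P_k`, where the isometry turns it into the pointwise
bound `|q| ≥ ε` almost everywhere on `{|f| ≤ k}`; then `k → ∞`. -/
theorem le_norm_Q (hJ : E.IsAssociated J) (hf : Measurable f)
    (hfin : E {p | f p = OnePoint.infty} = 0) {s : Cl n} {ε : ℝ} (hε : 0 < ε)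
    (h0 : E (qSublevel s f ε) = 0) (x : (spectralIntegral hJ hf).domain)
    (hx : spectralIntegral hJ hf x ∈ (spectralIntegral hJ hf).domain) :
    ε * ‖(x : CliffordModule n H)‖ ≤ ‖Q (spectralIntegral hJ hf) s x hx‖ := by
  refine le_of_tendsto_of_tendsto' ((tendsto_sublevel hf hfin (x : CliffordModule n H)).norm.const_mul ε)
    (tendsto_sublevel hf hfin _).norm fun k => ?_
  have hm := measurableSet_sublevel hf k
  refine (sq_le_sq₀ (by positivity) (norm_nonneg _)).1 ?_
  rw [sublevel_apply_Q, norm_boundedIntegral_sq, mul_pow, ← E.reMeasure_real _ hm]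
  have hae : ∀ᵐ p ∂(E.reMeasure (x : CliffordModule n H)), p ∉ qSublevel s f ε := by
    rw [ae_iff]
    simp only [not_not, Set.ofPred_mem_eq]
    rw [E.reMeasure_apply _ (measurableSet_qSublevel s hf ε), h0]
    simp
  have h1 : ε ^ 2 * (E.reMeasure (x : CliffordModule n H)).real (sublevel f k) =
      ∫ p, (sublevel f k).indicator (fun _ => ε ^ 2) p ∂(E.reMeasure (x : CliffordModule n H)) := by
    rw [integral_indicator_const _ hm, smul_eq_mul, mul_comm]
  rw [h1]
  refine integral_mono_ae ((integrable_const _).indicator hm) ?_ ?_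
  · obtain ⟨C, hC⟩ := bounded_truncQ s f k
    refine Integrable.of_bound
      ((measurable_truncQ s hf k).norm.pow_const 2).aestronglyMeasurable (C ^ 2)
      (Eventually.of_forall fun p => ?_)
    rw [Real.norm_of_nonneg (by positivity)]
    exact pow_le_pow_left₀ (norm_nonneg _) (hC p) 2
  · filter_upwards [hae] with p hp
    by_cases hk : p ∈ sublevel f k
    · rw [Set.indicator_of_mem hk]
      refine pow_le_pow_left₀ hε.le (not_lt.1 fun h => hp ?_) 2
      exact (norm_truncQ_lt_iff hk ε).1 h
    · rw [Set.indicator_of_notMem hk]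
      positivity

/-- Every vector in the range of `E {|f| ≤ k}` is in the range of `Q_s(𝕀(f))` if the latter function
is bounded away from zero. -/
theorem sublevel_apply_mem_range_Q (hJ : E.IsAssociated J) (hf : Measurable f)
    {s : Cl n} {ε : ℝ} (hε : 0 < ε) (h0 : E (qSublevel s f ε) = 0) (k : ℕ)
    (y : CliffordModule n H) :
    ∃ (x : (spectralIntegral hJ hf).domain)
      (hx : spectralIntegral hJ hf x ∈ (spectralIntegral hJ hf).domain),
      Q (spectralIntegral hJ hf) s x hx = E (sublevel f k) y := by
  have hm := measurableSet_sublevel hf k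
  have hq := measurableSet_qSublevel s hf ε
  -- The reciprocal of `q`, set to `0` where `|q| < ε` so that it is bounded by `ε⁻¹`.
  let r : Ω → ℂ := (sublevel f k \ qSublevel s f ε).indicator fun p => (truncQ s f k p)⁻¹
  have hlow : ∀ p ∈ sublevel f k \ qSublevel s f ε, ε ≤ ‖truncQ s f k p‖ := fun p hp =>
    not_lt.1 fun h => hp.2 ((norm_truncQ_lt_iff hp.1 ε).1 h)
  have hr : Measurable r := (measurable_truncQ s hf k).inv.indicator (hm.diff hq)
  have hrb : ∃ C, ∀ p, ‖r p‖ ≤ C := by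
    refine ⟨ε⁻¹, fun p => ?_⟩
    by_cases hp : p ∈ sublevel f k \ qSublevel s f ε
    · simp only [r]
      rw [Set.indicator_of_mem hp, norm_inv]
      exact inv_anti₀ hε (hlow p hp)
    · simp only [r]
      rw [Set.indicator_of_notMem hp, norm_zero]
      positivity
  -- As `r` vanishes off `{|f| ≤ k}`, the candidate preimage `𝕀(r) y` lies in the range of `P_k`,
  -- where `exists_Q_eq` applies.
  have hz : E (sublevel f k) (E.boundedIntegral hJ r hr hrb y) = E.boundedIntegral hJ r hr hrb y :=
    apply_boundedIntegral hJ hm hr hrb hr hrb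
      (by simp only [r]; rw [Set.indicator_indicator, Set.inter_eq_right.2 Set.sdiff_subset]) y
  obtain ⟨x, hx, -, hQ⟩ := exists_Q_eq hJ hf s hz
  refine ⟨x, hx, ?_⟩
  obtain ⟨hi, hib, h1⟩ := boundedIntegral_one_indicator hJ (hm.diff hq) y
  have e : (fun p => truncQ s f k p * r p) =
      (sublevel f k \ qSublevel s f ε).indicator fun _ => ((1 : ℝ) : ℂ) := by
    ext p
    by_cases hp : p ∈ sublevel f k \ qSublevel s f ε
    · have : truncQ s f k p ≠ 0 := norm_pos_iff.1 (hε.trans_le (hlow p hp))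
      simp only [r]
      rw [Set.indicator_of_mem hp, Set.indicator_of_mem hp, mul_inv_cancel₀ this]
      simp
    · simp only [r]
      rw [Set.indicator_of_notMem hp, Set.indicator_of_notMem hp, mul_zero]
  -- The part removed in defining `r` is `E`-null, so nothing is lost.
  have h2 : E (sublevel f k \ qSublevel s f ε) y = E (sublevel f k) y := by
    have h3 := E.union (hm.diff hq) (hm.inter hq) Set.disjoint_sdiff_inter
    rw [Set.sdiff_union_inter] at h3
    have h4 : E (sublevel f k ∩ qSublevel s f ε) y = 0 := by
      have h5 : (E.reMeasure y) (sublevel f k ∩ qSublevel s f ε) = 0 :=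
        measure_mono_null Set.inter_subset_right (by rw [E.reMeasure_apply y hq, h0]; simp)
      rw [E.reMeasure_apply y (hm.inter hq), ENNReal.ofReal_eq_zero] at h5
      exact norm_eq_zero.1 (pow_eq_zero_iff two_ne_zero |>.1 (le_antisymm h5 (by positivity)))
    rw [h3, add_apply, h4, add_zero]
  rw [hQ, ← h2, ← h1]
  have h6 : ∀ g, ∀ hg : g = fun p => truncQ s f k p * r p, ∀ hgm hgb,
      E.boundedIntegral hJ g hgm hgb y = E.boundedIntegral hJ (truncQ s f k)
        (measurable_truncQ s hf k) (bounded_truncQ s f k) (E.boundedIntegral hJ r hr hrb y) := by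
    rintro g rfl hgm hgb
    exact boundedIntegral_mul hJ _ _ hr hrb hgm hgb y
  exact (h6 _ e.symm hi hib).symm

/-- If the spectral projection of `{|f² - 2 Re(s) f + |s|²| < ε}` does not vanish, then
`Q_s(𝕀(f))` is bounded by `ε` at some nonzero vector. -/
theorem exists_norm_Q_le (hJ : E.IsAssociated J) (hf : Measurable f)
    (hfin : E {p | f p = OnePoint.infty} = 0) {s : Cl n} {ε : ℝ} (hε : 0 < ε)
    (h0 : E (qSublevel s f ε) ≠ 0) :
    ∃ (x : (spectralIntegral hJ hf).domain)
      (hx : spectralIntegral hJ hf x ∈ (spectralIntegral hJ hf).domain),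
      (x : CliffordModule n H) ≠ 0 ∧
        ‖Q (spectralIntegral hJ hf) s x hx‖ ≤ ε * ‖(x : CliffordModule n H)‖ := by
  have hq := measurableSet_qSublevel s hf ε
  obtain ⟨y, hy⟩ : ∃ y, E (qSublevel s f ε) y ≠ 0 := by
    by_contra! h
    exact h0 (by ext1 y; simpa using h y)
  -- Cutting by a large `k` keeps the vector nonzero and brings it into the domain of `Q_s(𝕀(f))`.
  obtain ⟨k, hk⟩ := ((tendsto_sublevel hf hfin (E (qSublevel s f ε) y)).eventually_ne hy).exists
  have hm := measurableSet_sublevel hf k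
  set z := E (sublevel f k) (E (qSublevel s f ε) y) with hzdef
  obtain ⟨x, hx, hxz, hQ⟩ := exists_Q_eq hJ hf s (E.apply_apply hm (E (qSublevel s f ε) y))
  rw [← hzdef] at hxz hQ
  refine ⟨x, hx, hxz ▸ hk, ?_⟩
  rw [hQ, hxz]
  -- The two projections commute, so `z` also lies in the range of `E {|q| < ε}`, and `μ_z` is
  -- carried by that set.
  have hnull : E (qSublevel s f ε)ᶜ z = 0 := by
    have h1 := boundedIntegral_one_indicator hJ hm (E (qSublevel s f ε) y)
    obtain ⟨hi, hib, h1⟩ := h1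
    have h2 := boundedIntegral_apply_range hJ hq hi hib
      (hi.indicator hq) (h := (qSublevel s f ε).indicator
        ((sublevel f k).indicator fun _ => ((1 : ℝ) : ℂ)))
      ⟨1, fun p => (norm_indicator_le_norm_self _ _).trans
        ((norm_indicator_le_norm_self _ _).trans (by simp))⟩ rfl y
    rw [hzdef, ← h1, h2,
      ← apply_boundedIntegral hJ hq hi hib (hi.indicator hq) _ rfl,
      E.mul_eq_zero hq.compl hq disjoint_compl_left]
  have hae : ∀ᵐ p ∂(E.reMeasure z), p ∈ qSublevel s f ε := by
    change E.reMeasure z (qSublevel s f ε)ᶜ = 0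
    rw [E.reMeasure_apply z hq.compl, hnull]
    simp
  refine (sq_le_sq₀ (norm_nonneg _) (by positivity)).1 ?_
  rw [norm_boundedIntegral_sq]
  calc ∫ p, ‖truncQ s f k p‖ ^ 2 ∂(E.reMeasure z) ≤ ∫ _, ε ^ 2 ∂(E.reMeasure z) := by
        refine integral_mono_of_nonneg (Eventually.of_forall fun p => by positivity)
          (integrable_const _) ?_
        filter_upwards [hae] with p hp
        refine pow_le_pow_left₀ (norm_nonneg _) ?_ 2
        by_cases hk : p ∈ sublevel f k
        · exact ((norm_truncQ_lt_iff hk ε).2 hp).le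
        · rw [truncQ, Set.indicator_of_notMem hk, norm_zero]
          exact hε.le
    _ = (ε * ‖z‖) ^ 2 := by
        rw [integral_const, E.reMeasure_real z MeasurableSet.univ, E.univ, smul_eq_mul,
          one_apply_eq_self]
        ring

theorem mem_sResolventSet_spectralIntegral_iff (hJ : E.IsAssociated J) (hf : Measurable f)
    (hfin : E {p | f p = OnePoint.infty} = 0) {s : Cl n} (hs : s ∈ Cl.paravectors n) :
    s ∈ sResolventSet (spectralIntegral hJ hf) ↔ ∃ ε : ℝ, 0 < ε ∧ E (qSublevel s f ε) = 0 := by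
  constructor
  · rintro ⟨-, -, -, C, hC⟩
    by_contra! h
    -- Chosen so that `|C| ε < 1`, which makes `‖x‖ ≤ |C| ε ‖x‖` impossible for `x ≠ 0`; the
    -- absolute value is taken because `C` has no given sign.
    have hε : 0 < (|C| + 1)⁻¹ := by positivity
    obtain ⟨x, hx, hx0, hQ⟩ := exists_norm_Q_le hJ hf hfin hε (h _ hε)
    have h1 : ‖(x : CliffordModule n H)‖ ≤ |C| * ((|C| + 1)⁻¹ * ‖(x : CliffordModule n H)‖) :=
      (hC x hx).trans (mul_le_mul (le_abs_self C) hQ (norm_nonneg _) (abs_nonneg C))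
    have h2 : 0 < ‖(x : CliffordModule n H)‖ := norm_pos_iff.2 hx0
    have h3 : |C| * (|C| + 1)⁻¹ < 1 := by
      rw [← div_eq_mul_inv, div_lt_one (by positivity)]
      linarith
    nlinarith
  · rintro ⟨ε, hε, h0⟩
    have hle := le_norm_Q hJ hf hfin hε h0
    refine ⟨hs, fun x hx hQ => ?_, fun y => ?_, ε⁻¹, fun x hx => ?_⟩
    · have h1 := hle x hx
      rw [hQ, norm_zero] at h1
      have h2 : ‖(x : CliffordModule n H)‖ = 0 :=
        le_antisymm (by by_contra h; nlinarith [mul_pos hε (not_le.1 h)]) (norm_nonneg _)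
      exact Subtype.ext (norm_eq_zero.1 h2)
    -- Each `P_k y` is in the range, and `P_k y → y`.
    · exact mem_closure_of_tendsto (tendsto_sublevel hf hfin y)
        (Eventually.of_forall fun k => sublevel_apply_mem_range_Q hJ hf hε h0 k y)
    · rw [inv_mul_eq_div, le_div_iff₀ hε, mul_comm]
      exact hle x hx

end

end SpectralMeasure

/-- The `S`-spectrum is a complement inside the paravectors, so membership in it requires this as
well as failure of the resolvent conditions. -/
theorem Cl.upperHalf_subset_paravectors {n : ℕ} {𝔧 : Cl n} (h𝔧 : 𝔧 ∈ Cl.unitSphere n) :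
    Cl.upperHalf 𝔧 ⊆ Cl.paravectors n := by
  rintro _ ⟨z, -, rfl⟩ α hα
  have h1 : α ≠ ∅ := by rintro rfl; simp at hα
  simp [Cl.slice, Cl.add_apply, Cl.smul_apply, Cl.one_apply, h1, h𝔧.1 α hα]

end CliffordSpectral

end

theorem mainTheorem8 {n : ℕ} {H : Type*} [NormedAddCommGroup H] [InnerProductSpace ℝ H]
    [CompleteSpace H] (𝔧 : CliffordSpectral.Cl n) (h𝔧 : 𝔧 ∈ CliffordSpectral.Cl.unitSphere n)
    (Ω : Set ℂ) (hΩ : ∀ z ∈ Ω, 0 ≤ z.im)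
    (E : CliffordSpectral.SpectralMeasure n H Ω)
    (J : CliffordSpectral.BoundedOp n H) (hJ : E.IsAssociated J)
    (f : Ω → OnePoint ℂ) (hf : Measurable f) (hfin : E {p | f p = OnePoint.infty} = 0)
    (hint : CliffordSpectral.IsIntrinsic f) :
    CliffordSpectral.sSpectrum (CliffordSpectral.SpectralMeasure.spectralIntegral hJ hf) ∩
        CliffordSpectral.Cl.upperHalf 𝔧 =
      {s | s ∈ CliffordSpectral.Cl.upperHalf 𝔧 ∧ ∀ ε : ℝ, 0 < ε →
        E {p | ∃ w : ℂ, f p = (w : OnePoint ℂ) ∧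
          ‖w ^ 2 - 2 * (s.re : ℂ) * w + (s.abs : ℂ) ^ 2‖ < ε} ≠ 0} := by

  ext s
  refine ⟨fun ⟨h1, h2⟩ => ⟨h2, fun ε hε h0 => h1.2 ?_⟩, fun ⟨h2, h⟩ => ?_⟩
  -- The set in the statement unfolds definitionally to `qSublevel s f ε`.
  · exact (CliffordSpectral.SpectralMeasure.mem_sResolventSet_spectralIntegral_iff hJ hf hfin
      h1.1).2 ⟨ε, hε, h0⟩
  · have hs := CliffordSpectral.Cl.upperHalf_subset_paravectors h𝔧 h2
    refine ⟨⟨hs, fun hr => ?_⟩, h2⟩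
    obtain ⟨ε, hε, h0⟩ :=
      (CliffordSpectral.SpectralMeasure.mem_sResolventSet_spectralIntegral_iff hJ hf hfin hs).1 hr
    exact h ε hε h0
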